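/- **Setting.** Let $n\ge 0$ and $\ell\ge 1$ be integers, let $0=\tau_0<\tau_1<\dots<\tau_\ell=\Delta$, and let $|\cdot|$ be the maximum norm on $\mathbb R^n$ and on $\mathbb R^{(\ell+1)n}$. Let $L^\infty=L^\infty([-\Delta,0],\mathbb R^n)$ with the essential supremum norm $\|\cdot\|$, and write $\phi^k\rightharpoonup\phi^0$ for weak-* convergence in $L^\infty$, i.e. $\int_{-\Delta}^0 g^T\phi^k\,ds\to\int_{-\Delta}^0 g^T\phi^0\,ds$ for all $g\in L^1([-\Delta,0],\mathbb R^n)$. For a function $\phi$ on $[-\Delta,0]$ and a function $x$ on an interval starting at $t_0$, let $\phi\diamond_{t_0}x$ be the function equal to $\phi(t-t_0)$ for $t\in[t_0-\Delta,t_0)$ and to $x(t)$ for $t\ge t_0$. For a function $\mathsf x$ put $\mathsf x_t(s)=\mathsf x(t+s)$, $s\in[-\Delta,0]$, and $\mathsf x(t-\tau_{0:\ell})=(\mathsf x(t-\tau_0),\dots,\mathsf x(t-\tau_\ell))$. **Assumptions on** $f:\mathbb R_{\ge0}\times\mathbb R^{(\ell+1)n}\times L^\infty\to\mathbb R^n$: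 1. For all $R>0$, $T>0$ there are $L\ge0$ and a null set $Z$ such that $|f(t,\xi,\phi)-f(t,\zeta,\psi)|\le L\max\{|\xi-\zeta|,\|\phi-\psi\|\}$ whenever $|\xi|,|\zeta|,\|\phi\|,\|\psi\|\le R$ and $t\in[0,T]\setminus Z$. 2. $f(\cdot,0,0)$ is locally essentially bounded. 3. For all $t_0\ge0$, $T>t_0$, all measurable essentially bounded $\phi:[-\Delta,0]\to\mathbb R^n$ and all continuous $x:[t_0,T]\to\mathbb R^n$, the function $t\mapsto f(t,\mathsf x(t-\tau_{0:\ell}),\mathsf x_t)$ with $\mathsf x=\phi\diamond_{t_0}x$ is Lebesgue measurable on $[t_0,T]$. 4. For all $T>0$, $R>0$ there is a null set $Z$ such that for all $\varepsilon>0$ and all sequences $\phi^k\rightharpoonup\phi^0$ with $\|\phi^k\|\le R$ there is $j$ with $|f(t,\xi,\phi^k)-f(t,\xi,\phi^0)|<\varepsilon$ for all $k\ge j$, $t\in[0,T]\setminus Z$ and $|\xi|\le R$. 5. For all $t_0\ge0$, $R\ge0$, all continuous $x:[t_0,t_0+\Delta]\to\mathbb R^n$ with $|x|\le R$, all sequences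 $\phi^k\rightharpoonup\phi^0$ with $\|\phi^k\|\le R$ and all $\varepsilon>0$ there is $j$ such that, with $\mathsf x^k=\phi^k\diamond_{t_0}x$ and $\mathsf x^0=\phi^0\diamond_{t_0}x$, for all $t\in[t_0,t_0+\Delta]$ and $k\ge j$ the following integral exists and satisfies $$\Big|\int_{t_0}^t\big[f(s,\mathsf x^k(s-\tau_{0:\ell}),\mathsf x^0_s)-f(s,\mathsf x^0(s-\tau_{0:\ell}),\mathsf x^0_s)\big]ds\Big|<\varepsilon .$$ **Solutions.** For $t_0\ge0$, $\xi\in\mathbb R^n$, $\phi\in L^\infty$, a solution on an interval $J=[t_0,b)$ or $[t_0,b]$, $t_0<b\le\infty$, is a locally absolutely continuous $x:J\to\mathbb R^n$ with $x(t)=\xi+\int_{t_0}^t f(s,\mathsf x(s-\tau_{0:\ell}),\mathsf x_s)\,ds$ for all $t\in J$, where $\mathsf x=\phi\diamond_{t_0}x$. It is maximal if no solution with the same data strictly extends it. **Theorem.** Let $f$ satisfy 1–5. For all $t_0\ge0$, $\xi\in\mathbb R^n$, $\phi\in L^\infty$ there is a unique maximal solution $x(\cdot;t_0,\xi,\phi)$,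 and its domain has the form $[t_0,T_{(t_0,\xi,\phi)})$ with $t_0<T_{(t_0,\xi,\phi)}\le\infty$. If $T>t_0\ge0$, $R>0$ and $$\inf_{|\xi|\le R,\ \|\phi\|\le R}T_{(t_0,\xi,\phi)}>T,$$ then $$\sup_{t\in[t_0,T],\ |\xi|\le R,\ \|\phi\|\le R}|x(t;t_0,\xi,\phi)|<\infty .$$ -/

import Mathlib

open MeasureTheory Filter Topology Set
open scoped ENNReal

noncomputable section

namespace DelaySystem

/-- Lebesgue measure on the interval `[-Δ, 0]`. -/
abbrev histMeasure (Δ : ℝ) : Measure ℝ := volume.restrict (Icc (-Δ) 0)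

/-- `L^∞([-Δ,0], ℝⁿ)` with the essential supremum norm; `ℝⁿ = Fin n → ℝ` carries the
maximum norm. -/
abbrev LInf (n : ℕ) (Δ : ℝ) : Type := Lp (Fin n → ℝ) ∞ (histMeasure Δ)

/-- The concatenation of a history `φ` (a function on `[-Δ,0]`) and a function `x` on an interval
that starts at `t₀`: it equals `φ (t - t₀)` for `t < t₀` and `x t` for `t₀ ≤ t`. -/
def concat {n : ℕ} (t₀ : ℝ) (φ x : ℝ → Fin n → ℝ) : ℝ → Fin n → ℝ :=
  fun t => if t < t₀ then φ (t - t₀) else x t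

open Classical in
/-- The class in `L^∞([-Δ,0], ℝⁿ)` of the history `s ↦ y (t + s)` of `y` at time `t`.
The value `0` is a default for histories that are not in `L^∞`; by `memLp_history` below it is not
met when `y` is the concatenation of an `L^∞` history and a continuous function. -/
def history {n : ℕ} (Δ : ℝ) (y : ℝ → Fin n → ℝ) (t : ℝ) : LInf n Δ :=
  if h : MemLp (fun s => y (t + s)) ∞ (histMeasure Δ) then h.toLp _ else 0

/-- The vector `(y (t - τ₀), …, y (t - τ_ℓ))` of the delayed values of `y`. -/
def delayed {n ℓ : ℕ} (τ : Fin (ℓ + 1) → ℝ) (y : ℝ → Fin n → ℝ) (t : ℝ) :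
    Fin (ℓ + 1) → Fin n → ℝ :=
  fun i => y (t - τ i)

/-- Right-hand sides `f(t, ξ_{0:ℓ}, φ)`. Only times `t ≥ 0` are ever used. -/
abbrev RHS (n ℓ : ℕ) (Δ : ℝ) : Type :=
  ℝ → (Fin (ℓ + 1) → Fin n → ℝ) → LInf n Δ → Fin n → ℝ

/-- Weak-* convergence of a sequence in `L^∞([-Δ,0], ℝⁿ)`, tested against `L¹([-Δ,0], ℝⁿ)`. -/
def WeakStarTendsto {n : ℕ} {Δ : ℝ} (φ : ℕ → LInf n Δ) (φ₀ : LInf n Δ) : Prop :=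
  ∀ g : ℝ → Fin n → ℝ, Integrable g (histMeasure Δ) →
    Tendsto (fun k => ∫ s, g s ⬝ᵥ φ k s ∂(histMeasure Δ)) atTop
      (𝓝 (∫ s, g s ⬝ᵥ φ₀ s ∂(histMeasure Δ)))

/-- The Lipschitz, boundedness and measurability conditions on a right-hand side. -/
structure LipschitzCaratheodory {n ℓ : ℕ} {Δ : ℝ} (τ : Fin (ℓ + 1) → ℝ) (f : RHS n ℓ Δ) :
    Prop where
  lipschitz : ∀ R > 0, ∀ T > 0, ∃ L ≥ 0, ∃ Z : Set ℝ, volume Z = 0 ∧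
    ∀ t ∈ Icc (0 : ℝ) T \ Z, ∀ ξ ζ : Fin (ℓ + 1) → Fin n → ℝ, ∀ φ ψ : LInf n Δ,
      ‖ξ‖ ≤ R → ‖ζ‖ ≤ R → ‖φ‖ ≤ R → ‖ψ‖ ≤ R →
        ‖f t ξ φ - f t ζ ψ‖ ≤ L * max ‖ξ - ζ‖ ‖φ - ψ‖
  bounded_zero : ∀ T > 0, ∃ C : ℝ, ∀ᵐ t ∂(volume.restrict (Icc 0 T)), ‖f t 0 0‖ ≤ C
  measurable : ∀ t₀ ≥ 0, ∀ T > t₀, ∀ φ x : ℝ → Fin n → ℝ,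
    MemLp φ ∞ (histMeasure Δ) → ContinuousOn x (Icc t₀ T) →
      AEStronglyMeasurable
        (fun t => f t (delayed τ (concat t₀ φ x) t) (history Δ (concat t₀ φ x) t))
        (volume.restrict (Icc t₀ T))

/-- The full assumption on a right-hand side: in addition to the Lipschitz, boundedness and
measurability conditions, weak-* continuity in the distributed-delay argument, uniformly in
`ξ_{0:ℓ}` in balls and in almost every `t` in compact intervals, and the integral condition on the
discrete delays (in which the integral is required to exist). -/
structure WeakStarRegular {n ℓ : ℕ} {Δ : ℝ} (τ : Fin (ℓ + 1) → ℝ) (f : RHS n ℓ Δ) : Prop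
    extends LipschitzCaratheodory τ f where
  weakStar_continuous : ∀ T > 0, ∀ R > 0, ∃ Z : Set ℝ, volume Z = 0 ∧
    ∀ ε > 0, ∀ (φ : ℕ → LInf n Δ) (φ₀ : LInf n Δ), (∀ k, ‖φ k‖ ≤ R) → WeakStarTendsto φ φ₀ →
      ∃ j : ℕ, ∀ k ≥ j, ∀ t ∈ Icc (0 : ℝ) T \ Z, ∀ ξ : Fin (ℓ + 1) → Fin n → ℝ, ‖ξ‖ ≤ R →
        ‖f t ξ (φ k) - f t ξ φ₀‖ < ε
  discrete_integral : ∀ t₀ ≥ 0, ∀ R ≥ 0, ∀ x : ℝ → Fin n → ℝ,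
    ContinuousOn x (Icc t₀ (t₀ + Δ)) → (∀ t ∈ Icc t₀ (t₀ + Δ), ‖x t‖ ≤ R) →
    ∀ (φ : ℕ → LInf n Δ) (φ₀ : LInf n Δ), (∀ k, ‖φ k‖ ≤ R) → WeakStarTendsto φ φ₀ →
    ∀ ε > 0, ∃ j : ℕ, ∀ t ∈ Icc t₀ (t₀ + Δ), ∀ k ≥ j,
      IntervalIntegrable
        (fun s => f s (delayed τ (concat t₀ (φ k) x) s) (history Δ (concat t₀ φ₀ x) s) -
          f s (delayed τ (concat t₀ φ₀ x) s) (history Δ (concat t₀ φ₀ x) s)) volume t₀ t ∧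
      ‖∫ s in t₀..t,
        (f s (delayed τ (concat t₀ (φ k) x) s) (history Δ (concat t₀ φ₀ x) s) -
          f s (delayed τ (concat t₀ φ₀ x) s) (history Δ (concat t₀ φ₀ x) s))‖ < ε

/-- The interval `[t₀, b)`, where `b` may be infinite. -/
def halfOpen (t₀ : ℝ) (b : EReal) : Set ℝ := {t | t₀ ≤ t ∧ (t : EReal) < b}

/-- Intervals of the form `[t₀, b)` or `[t₀, b]` with `t₀ < b ≤ ∞`. -/
def IsForwardInterval (t₀ : ℝ) (J : Set ℝ) : Prop :=
  ∃ b : EReal, (t₀ : EReal) < b ∧ (J = halfOpen t₀ b ∨ J = {t | t₀ ≤ t ∧ (t : EReal) ≤ b})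

/-- `x` is a solution on `J` of `x'(t) = f(t, 𝗑(t - τ_{0:ℓ}), 𝗑_t)` with `𝗑` the concatenation of
`φ` and `x` at `t₀`, and `x(t₀) = ξ`: it is locally absolutely continuous on `J` and satisfies the
integral equation there. Values of `x` outside `J` play no role. -/
structure IsSolution {n ℓ : ℕ} {Δ : ℝ} (τ : Fin (ℓ + 1) → ℝ) (f : RHS n ℓ Δ) (t₀ : ℝ)
    (ξ : Fin n → ℝ) (φ : LInf n Δ) (J : Set ℝ) (x : ℝ → Fin n → ℝ) : Prop where
  interval : IsForwardInterval t₀ J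
  locallyAC : ∀ t ∈ J, AbsolutelyContinuousOnInterval x t₀ t
  integrable : ∀ t ∈ J, IntervalIntegrable
    (fun s => f s (delayed τ (concat t₀ φ x) s) (history Δ (concat t₀ φ x) s)) volume t₀ t
  equation : ∀ t ∈ J,
    x t = ξ + ∫ s in t₀..t, f s (delayed τ (concat t₀ φ x) s) (history Δ (concat t₀ φ x) s)

/-- A solution that has no strict extension to a solution on a larger interval. -/
def IsMaximalSolution {n ℓ : ℕ} {Δ : ℝ} (τ : Fin (ℓ + 1) → ℝ) (f : RHS n ℓ Δ) (t₀ : ℝ)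
    (ξ : Fin n → ℝ) (φ : LInf n Δ) (J : Set ℝ) (x : ℝ → Fin n → ℝ) : Prop :=
  IsSolution τ f t₀ ξ φ J x ∧
    ∀ (J' : Set ℝ) (y : ℝ → Fin n → ℝ), IsSolution τ f t₀ ξ φ J' y → J ⊆ J' → EqOn x y J → J' = J

/-- The histories that occur in the system are in `L^∞`. -/
theorem memLp_history {n : ℕ} {Δ t₀ T : ℝ} {φ x : ℝ → Fin n → ℝ}
    (hφ : MemLp φ ∞ (histMeasure Δ)) (hx : ContinuousOn x (Icc t₀ T)) {t : ℝ}
    (ht : t ∈ Icc t₀ T) :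
    MemLp (fun s => concat t₀ φ x (t + s)) ∞ (histMeasure Δ) := by
  have hshift : MeasurePreserving (fun s : ℝ => s + (t - t₀))
      (volume.restrict ((fun s : ℝ => s + (t - t₀)) ⁻¹' Icc (-Δ) 0)) (histMeasure Δ) :=
    (measurePreserving_add_right volume (t - t₀)).restrict_preimage measurableSet_Icc
  have h₁ : MemLp (fun s => φ (s + (t - t₀))) ∞ ((histMeasure Δ).restrict (Iio (t₀ - t))) := by
    refine (hφ.comp_measurePreserving hshift).mono_measure ?_
    rw [histMeasure, Measure.restrict_restrict measurableSet_Iio]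
    refine Measure.restrict_mono ?_ le_rfl
    rintro s ⟨hs, hs', -⟩
    simp only [mem_Iio] at hs
    simp only [mem_preimage, mem_Icc]
    exact ⟨by linarith [ht.1], by linarith⟩
  have h₂ : MemLp (fun s => x (t + s)) ∞ ((histMeasure Δ).restrict (Iio (t₀ - t))ᶜ) := by
    have hc : ContinuousOn (fun s => x (t + s)) (Icc (t₀ - t) 0) := by
      refine hx.comp (by fun_prop) fun s hs => ?_
      exact ⟨by linarith [hs.1], by linarith [hs.2, ht.2]⟩
    obtain ⟨C, hC⟩ := isCompact_Icc.exists_bound_of_continuousOn hc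
    have h : MemLp (fun s => x (t + s)) ∞ (volume.restrict (Icc (t₀ - t) 0)) :=
      memLp_top_of_bound (hc.aestronglyMeasurable measurableSet_Icc) C
        ((ae_restrict_iff' measurableSet_Icc).2 (Eventually.of_forall hC))
    refine h.mono_measure ?_
    rw [histMeasure, Measure.restrict_restrict measurableSet_Iio.compl]
    refine Measure.restrict_mono ?_ le_rfl
    rintro s ⟨hs, -, hs'⟩
    simp only [mem_compl_iff, mem_Iio, not_lt] at hs
    exact ⟨hs, hs'⟩
  classical
  convert MemLp.piecewise measurableSet_Iio h₁ h₂ using 1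
  funext s
  by_cases hs : t + s < t₀
  · have : s ∈ Iio (t₀ - t) := by simp only [mem_Iio]; linarith
    rw [piecewise_eq_of_mem _ _ _ this]
    simp only [concat, if_pos hs]
    congr 1
    ring
  · have : s ∉ Iio (t₀ - t) := by simp only [mem_Iio]; linarith
    rw [piecewise_eq_of_notMem _ _ _ this]
    simp only [concat, if_neg hs]

end DelaySystem

end

/-!
Truncating the state at a level `N` makes the right-hand side globally Lipschitz, so that on
`[t₀, T]` the Picard map is a contraction for Bielecki's weighted norm. A solution of the truncated
equation that stays below `N` solves the original one; local existence, uniqueness and continuation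
follow, and with them the unique maximal solution.

If the solutions on `[t₀, T]` with data in the ball of radius `R` were unbounded, take data
`(ξₖ, φₖ)` whose solutions exceed `k` in norm somewhere. Balls of `L^∞` are weak-* sequentially
compact (bounded sequences have weak limits in the Hilbert space `L²`), so a subsequence of the data
converges to some `(ξ₀, φ₀)` in the same ball, and its solution `x₀` exists on `[t₀, T]`. By the two
weak-* hypotheses `x₀` satisfies the integral equation with data `(ξₖ, φₖ)` up to an error that
tends to `0` uniformly. Stability of the contraction's fixed point turns this into uniform
convergence of the solutions to `x₀`, a contradiction.
-/

open scoped NNReal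

noncomputable section

namespace DelaySystem

section Volterra

variable {E : Type*} [NormedAddCommGroup E] {a b : ℝ} {L : ℝ≥0} {G : (ℝ → E) → ℝ → E} {ξ : E}
  {x z : ℝ → E}

/-- The right-hand side `G` of a Volterra equation on `[a, b]` maps continuous functions to
integrable ones, and `G x s` depends on the values of `x` on `[a, s]` in a Lipschitz way, with
respect to the maximum norm on `[a, s]`. -/
structure RetardedLipschitz (a b : ℝ) (L : ℝ≥0) (G : (ℝ → E) → ℝ → E) : Prop where
  integrableOn : ∀ x, ContinuousOn x (Icc a b) → IntegrableOn (G x) (Icc a b)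
  lipschitz : ∀ x y, ContinuousOn x (Icc a b) → ContinuousOn y (Icc a b) →
    ∀ᵐ s ∂volume.restrict (Icc a b), ∀ C, (∀ u ∈ Icc a s, ‖x u - y u‖ ≤ C) →
      ‖G x s - G y s‖ ≤ L * C

theorem RetardedLipschitz.intervalIntegrable (hG : RetardedLipschitz a b L G)
    (hx : ContinuousOn x (Icc a b)) {t : ℝ} (ht : t ∈ Icc a b) :
    IntervalIntegrable (G x) volume a t :=
  (intervalIntegrable_iff_integrableOn_Icc_of_le ht.1).2
    ((hG.integrableOn x hx).mono_set (Icc_subset_Icc_right ht.2))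

variable [NormedSpace ℝ E]

/-- `x` is a continuous solution on `[a, b]` of the integral equation `x = ξ + ∫ G x` of Volterra
type. -/
structure IsIntegralSolution (G : (ℝ → E) → ℝ → E) (a b : ℝ) (ξ : E) (x : ℝ → E) : Prop where
  continuousOn : ContinuousOn x (Icc a b)
  equation : ∀ t ∈ Icc a b, x t = ξ + ∫ s in a..t, G x s

theorem IsIntegralSolution.mono (hx : IsIntegralSolution G a b ξ x) {c : ℝ} (hc : c ≤ b) :
    IsIntegralSolution G a c ξ x :=
  ⟨hx.continuousOn.mono (Icc_subset_Icc_right hc),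
    fun t ht => hx.equation t (Icc_subset_Icc_right hc ht)⟩

theorem RetardedLipschitz.integral_congr (hG : RetardedLipschitz a b L G)
    (hx : ContinuousOn x (Icc a b)) (hz : ContinuousOn z (Icc a b)) (h : EqOn x z (Icc a b))
    {t : ℝ} (ht : t ∈ Icc a b) : ∫ s in a..t, G x s = ∫ s in a..t, G z s := by
  refine intervalIntegral.integral_congr_ae ?_
  filter_upwards [(ae_restrict_iff' measurableSet_Icc).1 (hG.lipschitz x z hx hz)] with s hs hst
  rw [uIoc_of_le ht.1] at hst
  have hsb : s ≤ b := hst.2.trans ht.2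
  have hle := hs ⟨hst.1.le, hsb⟩ 0 fun u hu => by simp [h ⟨hu.1, hu.2.trans hsb⟩]
  rwa [mul_zero, norm_le_zero_iff, sub_eq_zero] at hle

theorem norm_integral_le_exp {g : ℝ → E} {M : ℝ} (hM : 0 ≤ M)
    (hg : ∀ᵐ s ∂volume.restrict (Icc a b), ‖g s‖ ≤ L * (Real.exp (2 * L * (s - a)) * M))
    {t : ℝ} (ht : t ∈ Icc a b) :
    ‖∫ s in a..t, g s‖ ≤ Real.exp (2 * L * (t - a)) * (M / 2) := by
  have hderiv : ∀ s ∈ uIcc a t, HasDerivAt (fun s => Real.exp (2 * L * (s - a)) * (M / 2))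
      (L * (Real.exp (2 * L * (s - a)) * M)) s := fun s _ =>
    ((((hasDerivAt_id' s).sub_const a).const_mul (2 * (L : ℝ))).exp.mul_const
      (M / 2)).congr_deriv (by ring)
  have hint : IntervalIntegrable (fun s => L * (Real.exp (2 * L * (s - a)) * M)) volume a t :=
    Continuous.intervalIntegrable (by fun_prop) _ _
  have hle : ∀ᵐ s, s ∈ Ioc a t → ‖g s‖ ≤ L * (Real.exp (2 * L * (s - a)) * M) := by
    filter_upwards [(ae_restrict_iff' measurableSet_Icc).1 hg] with s hs hst
    exact hs ⟨hst.1.le, hst.2.trans ht.2⟩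
  calc ‖∫ s in a..t, g s‖
      ≤ ∫ s in a..t, L * (Real.exp (2 * L * (s - a)) * M) :=
        intervalIntegral.norm_integral_le_of_norm_le ht.1 hle hint
    _ = Real.exp (2 * L * (t - a)) * (M / 2) - M / 2 := by
        rw [intervalIntegral.integral_eq_sub_of_hasDerivAt hderiv hint]
        simp
    _ ≤ Real.exp (2 * L * (t - a)) * (M / 2) := sub_le_self _ (by positivity)

/-- The path `t ↦ e^{2L(t-a)} y(t)`. Weighting paths in this way (Bielecki's norm) turns the Picard
map into a contraction on an interval of any length. -/
def expPath (L : ℝ≥0) (hab : a ≤ b) (y : C(Icc a b, E)) (t : ℝ) : E :=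
  Real.exp (2 * L * (t - a)) • IccExtend hab y t

theorem continuous_expPath (hab : a ≤ b) (y : C(Icc a b, E)) : Continuous (expPath L hab y) := by
  have hy : Continuous (IccExtend hab y) := y.continuous.Icc_extend'
  exact Continuous.smul (by fun_prop) hy

theorem norm_expPath_sub_le (hab : a ≤ b) (y y' : C(Icc a b, E)) (t : ℝ) :
    ‖expPath L hab y t - expPath L hab y' t‖ ≤ Real.exp (2 * L * (t - a)) * dist y y' := by
  rw [expPath, expPath, ← smul_sub, norm_smul, Real.norm_of_nonneg (Real.exp_pos _).le,
    ← dist_eq_norm]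
  gcongr
  exact ContinuousMap.dist_apply_le_dist (projIcc a b hab t)

/-- The element `t ↦ e^{-2L(t-a)} x(t)` of `C([a, b])`, where `x` is continuous on `[a, b]`. -/
def expWeighted (L : ℝ≥0) (hx : ContinuousOn x (Icc a b)) : C(Icc a b, E) where
  toFun t := Real.exp (-(2 * L * (t - a))) • x t
  continuous_toFun := by
    have := hx.domRestrict
    exact Continuous.smul (by fun_prop) this

theorem expPath_expWeighted (hab : a ≤ b) (hx : ContinuousOn x (Icc a b)) :
    EqOn (expPath L hab (expWeighted L hx)) x (Icc a b) := fun t ht => by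
  rw [expPath, IccExtend_of_mem hab _ ht]
  exact (smul_smul _ _ _).trans (by rw [← Real.exp_add, add_neg_cancel, Real.exp_zero, one_smul])

theorem dist_expWeighted_le (hx : ContinuousOn x (Icc a b)) (hz : ContinuousOn z (Icc a b)) {C : ℝ}
    (hC : 0 ≤ C) (h : ∀ t ∈ Icc a b, ‖x t - z t‖ ≤ Real.exp (2 * L * (t - a)) * C) :
    dist (expWeighted L hx) (expWeighted L hz) ≤ C := by
  refine (ContinuousMap.dist_le hC).2 fun t => ?_
  calc dist (expWeighted L hx t) (expWeighted L hz t)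
      = Real.exp (-(2 * L * (t - a))) * ‖x t - z t‖ := by
        rw [dist_eq_norm, ← Real.norm_of_nonneg (Real.exp_pos (-(2 * L * (t - a)))).le,
          ← norm_smul, smul_sub]
        rfl
    _ ≤ Real.exp (-(2 * L * (t - a))) * (Real.exp (2 * L * (t - a)) * C) := by
        gcongr
        exact h t t.2
    _ = C := by rw [← mul_assoc, ← Real.exp_add, neg_add_cancel, Real.exp_zero, one_mul]

theorem RetardedLipschitz.continuousOn_add_integral (hG : RetardedLipschitz a b L G) (hab : a ≤ b)
    (ξ : E) (hx : ContinuousOn x (Icc a b)) :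
    ContinuousOn (fun t => ξ + ∫ s in a..t, G x s) (Icc a b) := by
  have h := intervalIntegral.continuousOn_primitive_interval'
    (hG.intervalIntegrable hx (right_mem_Icc.2 hab)) left_mem_uIcc
  rw [uIcc_of_le hab] at h
  exact continuousOn_const.add h

/-- The Picard map `x ↦ ξ + ∫ G x`, written for the weighted paths `y(t) = e^{-2L(t-a)} x(t)`. -/
def RetardedLipschitz.weightedPicard (hG : RetardedLipschitz a b L G) (hab : a ≤ b) (ξ : E)
    (y : C(Icc a b, E)) : C(Icc a b, E) :=
  expWeighted L
    (hG.continuousOn_add_integral hab ξ (continuous_expPath (L := L) hab y).continuousOn)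

theorem RetardedLipschitz.contractingWith_weightedPicard (hG : RetardedLipschitz a b L G)
    (hab : a ≤ b) (ξ : E) : ContractingWith (1 / 2) (hG.weightedPicard hab ξ) := by
  refine ⟨by rw [← NNReal.coe_lt_coe]; norm_num, LipschitzWith.of_dist_le_mul fun y y' => ?_⟩
  have hy := (continuous_expPath (L := L) hab y).continuousOn (s := Icc a b)
  have hy' := (continuous_expPath (L := L) hab y').continuousOn (s := Icc a b)
  suffices ∀ t ∈ Icc a b, ‖(∫ s in a..t, G (expPath L hab y) s) -
      ∫ s in a..t, G (expPath L hab y') s‖ ≤ Real.exp (2 * L * (t - a)) * (dist y y' / 2) by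
    refine (dist_expWeighted_le _ _ (by positivity) fun t ht => ?_).trans_eq
      (show dist y y' / 2 = _ by push_cast; ring)
    rw [add_sub_add_left_eq_sub]
    exact this t ht
  intro t ht
  rw [← intervalIntegral.integral_sub (hG.intervalIntegrable hy ht) (hG.intervalIntegrable hy' ht)]
  refine norm_integral_le_exp dist_nonneg ?_ ht
  filter_upwards [hG.lipschitz _ _ hy hy'] with s hs
  refine hs _ fun u hu => (norm_expPath_sub_le hab y y' u).trans ?_
  have := hu.2
  gcongr

theorem RetardedLipschitz.weightedPicard_expWeighted (hG : RetardedLipschitz a b L G) (hab : a ≤ b)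
    (ξ : E) (hx : ContinuousOn x (Icc a b)) :
    hG.weightedPicard hab ξ (expWeighted L hx) =
      expWeighted L (hG.continuousOn_add_integral hab ξ hx) := by
  ext t
  exact congrArg (fun v => Real.exp (-(2 * L * (t - a))) • (ξ + v))
    (hG.integral_congr (continuous_expPath hab _).continuousOn hx (expPath_expWeighted hab hx) t.2)

theorem RetardedLipschitz.exists_isIntegralSolution [CompleteSpace E]
    (hG : RetardedLipschitz a b L G) (hab : a ≤ b) (ξ : E) :
    ∃ x, IsIntegralSolution G a b ξ x := by
  have hQ := hG.contractingWith_weightedPicard hab ξ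
  set y := ContractingWith.fixedPoint _ hQ
  have hcont := (continuous_expPath (L := L) hab y).continuousOn (s := Icc a b)
  refine ⟨expPath L hab y, hcont, fun t ht => ?_⟩
  calc expPath L hab y t = expPath L hab (hG.weightedPicard hab ξ y) t := by
        rw [hQ.fixedPoint_isFixedPt.eq]
    _ = ξ + ∫ s in a..t, G (expPath L hab y) s :=
        expPath_expWeighted hab (hG.continuousOn_add_integral hab ξ hcont) ht

theorem RetardedLipschitz.norm_sub_le_of_norm_add_integral_sub_le
    (hG : RetardedLipschitz a b L G) (hz : IsIntegralSolution G a b ξ z)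
    (hx : ContinuousOn x (Icc a b)) {ε : ℝ}
    (h : ∀ t ∈ Icc a b, ‖ξ + (∫ s in a..t, G x s) - x t‖ ≤ ε) {t : ℝ} (ht : t ∈ Icc a b) :
    ‖z t - x t‖ ≤ Real.exp (2 * L * (t - a)) * (2 * ε) := by
  have hab := ht.1.trans ht.2
  have hε : 0 ≤ ε := (norm_nonneg _).trans (h t ht)
  have hfix : Function.IsFixedPt (hG.weightedPicard hab ξ) (expWeighted L hz.continuousOn) := by
    rw [Function.IsFixedPt, weightedPicard_expWeighted]
    ext s
    exact congrArg (Real.exp (-(2 * L * (s - a))) • ·) (hz.equation s s.2).symm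
  have hdefect : dist (expWeighted L hx) (hG.weightedPicard hab ξ (expWeighted L hx)) ≤ ε := by
    rw [weightedPicard_expWeighted, dist_comm]
    refine dist_expWeighted_le _ _ hε fun s hs => (h s hs).trans (le_mul_of_one_le_left hε ?_)
    rw [Real.one_le_exp_iff]
    have := sub_nonneg.2 hs.1
    positivity
  have hdist : dist (expWeighted L hz.continuousOn) (expWeighted L hx) ≤ 2 * ε := by
    rw [dist_comm]
    refine ((hG.contractingWith_weightedPicard hab ξ).dist_le_of_fixedPoint _ hfix).trans ?_
    rw [div_le_iff₀ (by norm_num)]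
    push_cast
    linarith
  rw [← expPath_expWeighted (L := L) hab hz.continuousOn ht,
    ← expPath_expWeighted (L := L) hab hx ht]
  refine (norm_expPath_sub_le hab _ _ t).trans ?_
  gcongr

theorem RetardedLipschitz.eqOn (hG : RetardedLipschitz a b L G)
    (hx : IsIntegralSolution G a b ξ x) (hz : IsIntegralSolution G a b ξ z) :
    EqOn x z (Icc a b) := fun t ht => by
  have h := hG.norm_sub_le_of_norm_add_integral_sub_le hx hz.continuousOn (ε := 0)
    (fun s hs => by rw [← hz.equation s hs, sub_self, norm_zero]) ht
  rwa [mul_zero, mul_zero, norm_le_zero_iff, sub_eq_zero] at h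

end Volterra

section Paths

theorem ae_norm_le_norm_lpTop {α E : Type*} [MeasurableSpace α] {μ : Measure α}
    [NormedAddCommGroup E] (φ : Lp E ∞ μ) : ∀ᵐ s ∂μ, ‖φ s‖ ≤ ‖φ‖ := by
  filter_upwards [ae_le_lpNorm_exponent_top (Lp.memLp φ)] with s hs
  rwa [Lp.norm_def, toReal_eLpNorm (Lp.aestronglyMeasurable φ)]

theorem norm_lpTop_le_of_ae {α E : Type*} [MeasurableSpace α] {μ : Measure α}
    [NormedAddCommGroup E] {φ : Lp E ∞ μ} {C : ℝ} (hC : 0 ≤ C) (h : ∀ᵐ s ∂μ, ‖φ s‖ ≤ C) :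
    ‖φ‖ ≤ C := by
  rw [Lp.norm_def, eLpNorm_exponent_top]
  exact ENNReal.toReal_le_of_le_ofReal hC (eLpNormEssSup_le_of_ae_bound h)

variable {n ℓ : ℕ} {Δ : ℝ} {τ : Fin (ℓ + 1) → ℝ} {t₀ T R : ℝ}

theorem concat_of_lt {φ x : ℝ → Fin n → ℝ} {t : ℝ} (h : t < t₀) :
    concat t₀ φ x t = φ (t - t₀) := if_pos h

theorem concat_of_le {φ x : ℝ → Fin n → ℝ} {t : ℝ} (h : t₀ ≤ t) :
    concat t₀ φ x t = x t := if_neg (not_lt.2 h)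

theorem eqOn_concat_Iic {φ x y : ℝ → Fin n → ℝ} {s : ℝ} (h : EqOn x y (Icc t₀ s)) :
    EqOn (concat t₀ φ x) (concat t₀ φ y) (Iic s) := fun t hts => by
  rcases lt_or_ge t t₀ with hlt | hge
  · rw [concat_of_lt hlt, concat_of_lt hlt]
  · rw [concat_of_le hge, concat_of_le hge, h ⟨hge, hts⟩]

theorem eqOn_concat_Ici (φ ψ x : ℝ → Fin n → ℝ) :
    EqOn (concat t₀ φ x) (concat t₀ ψ x) (Ici t₀) := fun t ht => by
  rw [concat_of_le ht, concat_of_le ht]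

theorem norm_concat_sub_le {φ x y : ℝ → Fin n → ℝ} {s t C : ℝ} (hC : 0 ≤ C)
    (h : ∀ u ∈ Icc t₀ s, ‖x u - y u‖ ≤ C) (hts : t ≤ s) :
    ‖concat t₀ φ x t - concat t₀ φ y t‖ ≤ C := by
  rcases lt_or_ge t t₀ with hlt | hge
  · rwa [concat_of_lt hlt, concat_of_lt hlt, sub_self, norm_zero]
  · rw [concat_of_le hge, concat_of_le hge]
    exact h t ⟨hge, hts⟩

theorem ae_norm_concat_le {φ : LInf n Δ} {x : ℝ → Fin n → ℝ} (hφ : ‖φ‖ ≤ R)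
    (hx : ∀ t ∈ Icc t₀ T, ‖x t‖ ≤ R) :
    ∀ᵐ r, r ∈ Icc (t₀ - Δ) T → ‖concat t₀ φ x r‖ ≤ R := by
  have hae := (ae_restrict_iff' measurableSet_Icc).1 (ae_norm_le_norm_lpTop φ)
  filter_upwards [(measurePreserving_sub_right volume t₀).quasiMeasurePreserving.ae hae]
    with r hr hmem
  rcases lt_or_ge r t₀ with hlt | hge
  · rw [concat_of_lt hlt]
    exact (hr ⟨by linarith [hmem.1], by linarith⟩).trans hφ
  · rw [concat_of_le hge]
    exact hx r ⟨hge, hmem.2⟩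

theorem ae_norm_delayed_le (hτ : ∀ i, τ i ∈ Icc 0 Δ) {φ : LInf n Δ} {x : ℝ → Fin n → ℝ}
    (hφ : ‖φ‖ ≤ R) (hx : ∀ t ∈ Icc t₀ T, ‖x t‖ ≤ R) :
    ∀ᵐ s ∂volume.restrict (Icc t₀ T), ‖delayed τ (concat t₀ φ x) s‖ ≤ R := by
  have hshift : ∀ i, ∀ᵐ s, s - τ i ∈ Icc (t₀ - Δ) T → ‖concat t₀ φ x (s - τ i)‖ ≤ R := fun i =>
    (measurePreserving_sub_right volume (τ i)).quasiMeasurePreserving.ae (ae_norm_concat_le hφ hx)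
  filter_upwards [ae_restrict_of_ae (ae_all_iff.2 hshift), ae_restrict_mem measurableSet_Icc]
    with s hs hmem
  refine (pi_norm_le_iff_of_nonneg ((norm_nonneg _).trans hφ)).2 fun i => hs i ⟨?_, ?_⟩
  · linarith [(hτ i).2, hmem.1]
  · linarith [(hτ i).1, hmem.2]

theorem norm_delayed_sub_le (hτ : ∀ i, 0 ≤ τ i) {φ x y : ℝ → Fin n → ℝ} {s C : ℝ} (hC : 0 ≤ C)
    (h : ∀ u ∈ Icc t₀ s, ‖x u - y u‖ ≤ C) :
    ‖delayed τ (concat t₀ φ x) s - delayed τ (concat t₀ φ y) s‖ ≤ C :=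
  (pi_norm_le_iff_of_nonneg hC).2 fun i => norm_concat_sub_le hC h (sub_le_self s (hτ i))

theorem history_ae_eq {φ x : ℝ → Fin n → ℝ} (hφ : MemLp φ ∞ (histMeasure Δ))
    (hx : ContinuousOn x (Icc t₀ T)) {t : ℝ} (ht : t ∈ Icc t₀ T) :
    history Δ (concat t₀ φ x) t =ᵐ[histMeasure Δ] fun s => concat t₀ φ x (t + s) := by
  rw [history, dif_pos (memLp_history hφ hx ht)]
  exact MemLp.coeFn_toLp _

theorem history_congr {y z : ℝ → Fin n → ℝ} {t : ℝ} (h : EqOn y z (Icc (t - Δ) t)) :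
    history Δ y t = history Δ z t := by
  have hae : (fun s => y (t + s)) =ᵐ[histMeasure Δ] fun s => z (t + s) :=
    (ae_restrict_iff' measurableSet_Icc).2 (Eventually.of_forall fun s hs =>
      h ⟨by linarith [hs.1], by linarith [hs.2]⟩)
  unfold history
  split_ifs with hy hz hz
  · exact MemLp.toLp_congr hy hz hae
  · exact absurd ((memLp_congr_ae hae).1 hy) hz
  · exact absurd ((memLp_congr_ae hae).2 hz) hy
  · rfl

theorem norm_history_le {φ : LInf n Δ} {x : ℝ → Fin n → ℝ} (hφ : ‖φ‖ ≤ R)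
    (hx : ContinuousOn x (Icc t₀ T)) (hxR : ∀ t ∈ Icc t₀ T, ‖x t‖ ≤ R) {t : ℝ}
    (ht : t ∈ Icc t₀ T) : ‖history Δ (concat t₀ φ x) t‖ ≤ R := by
  have hshift : ∀ᵐ s, t + s ∈ Icc (t₀ - Δ) T → ‖concat t₀ φ x (t + s)‖ ≤ R :=
    (measurePreserving_add_left volume t).quasiMeasurePreserving.ae (ae_norm_concat_le hφ hxR)
  refine norm_lpTop_le_of_ae ((norm_nonneg _).trans hφ) ?_
  filter_upwards [history_ae_eq (Lp.memLp φ) hx ht, ae_restrict_of_ae hshift,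
    ae_restrict_mem measurableSet_Icc] with s hs hle hmem
  rw [hs]
  exact hle ⟨by linarith [ht.1, hmem.1], by linarith [ht.2, hmem.2]⟩

theorem norm_history_sub_le {φ : LInf n Δ} {x y : ℝ → Fin n → ℝ}
    (hx : ContinuousOn x (Icc t₀ T)) (hy : ContinuousOn y (Icc t₀ T)) {t C : ℝ}
    (ht : t ∈ Icc t₀ T) (h : ∀ u ∈ Icc t₀ t, ‖x u - y u‖ ≤ C) :
    ‖history Δ (concat t₀ φ x) t - history Δ (concat t₀ φ y) t‖ ≤ C := by
  have hC : 0 ≤ C := (norm_nonneg _).trans (h t (right_mem_Icc.2 ht.1))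
  refine norm_lpTop_le_of_ae hC ?_
  filter_upwards [history_ae_eq (Lp.memLp φ) hx ht, history_ae_eq (Lp.memLp φ) hy ht,
    Lp.coeFn_sub (history Δ (concat t₀ φ x) t) (history Δ (concat t₀ φ y) t),
    ae_restrict_mem measurableSet_Icc] with s hxs hys hsub hmem
  rw [hsub, Pi.sub_apply, hxs, hys]
  exact norm_concat_sub_le hC h (by linarith [hmem.2])

theorem exists_common_bound (φ : LInf n Δ) {x : ℝ → Fin n → ℝ} (hx : ContinuousOn x (Icc t₀ T)) :
    ∃ R, ‖φ‖ ≤ R ∧ ∀ t ∈ Icc t₀ T, ‖x t‖ ≤ R := by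
  obtain ⟨C, hC⟩ := isCompact_Icc.exists_bound_of_continuousOn hx
  exact ⟨max ‖φ‖ C, le_max_left _ _, fun t ht => (hC t ht).trans (le_max_right _ _)⟩

end Paths

section Trajectories

variable {n ℓ : ℕ} {Δ : ℝ} {τ : Fin (ℓ + 1) → ℝ} {f : RHS n ℓ Δ} {t₀ T R : ℝ}

/-- The right-hand side `f` with the discrete delays read off the path `y` and the history off the
path `z`. -/
def mixedRHS (τ : Fin (ℓ + 1) → ℝ) (f : RHS n ℓ Δ) (y z : ℝ → Fin n → ℝ) (s : ℝ) : Fin n → ℝ :=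
  f s (delayed τ y s) (history Δ z s)

/-- The right-hand side `f` along the path `y`. -/
def pathRHS (τ : Fin (ℓ + 1) → ℝ) (f : RHS n ℓ Δ) (y : ℝ → Fin n → ℝ) : ℝ → Fin n → ℝ :=
  mixedRHS τ f y y

theorem pathRHS_congr (hτ : ∀ i, τ i ∈ Icc 0 Δ) {y z : ℝ → Fin n → ℝ} {s : ℝ}
    (h : EqOn y z (Icc (s - Δ) s)) : pathRHS τ f y s = pathRHS τ f z s := by
  have hdelayed : delayed τ y s = delayed τ z s :=
    funext fun i => h ⟨by linarith [(hτ i).2], by linarith [(hτ i).1]⟩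
  rw [pathRHS, pathRHS, mixedRHS, mixedRHS, hdelayed, history_congr h]

theorem integral_pathRHS_congr (hτ : ∀ i, τ i ∈ Icc 0 Δ) {φ x y : ℝ → Fin n → ℝ} {t : ℝ}
    (ht : t₀ ≤ t) (h : EqOn x y (Icc t₀ t)) :
    ∫ s in t₀..t, pathRHS τ f (concat t₀ φ x) s = ∫ s in t₀..t, pathRHS τ f (concat t₀ φ y) s := by
  refine intervalIntegral.integral_congr fun s hs => ?_
  rw [uIcc_of_le ht] at hs
  exact pathRHS_congr hτ
    ((eqOn_concat_Iic (h.mono (Icc_subset_Icc_right hs.2))).mono Icc_subset_Iic_self)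

theorem LipschitzCaratheodory.exists_ae_lipschitz (hf : LipschitzCaratheodory τ f) (R T : ℝ) :
    ∃ L : ℝ≥0, ∀ᵐ t ∂volume.restrict (Icc 0 T), ∀ ξ ζ : Fin (ℓ + 1) → Fin n → ℝ,
      ∀ φ ψ : LInf n Δ, ‖ξ‖ ≤ R → ‖ζ‖ ≤ R → ‖φ‖ ≤ R → ‖ψ‖ ≤ R →
        ‖f t ξ φ - f t ζ ψ‖ ≤ L * max ‖ξ - ζ‖ ‖φ - ψ‖ := by
  obtain ⟨L, hL, Z, hZ, h⟩ := hf.lipschitz (max R 1) (by positivity) (max T 1) (by positivity)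
  refine ⟨⟨L, hL⟩, ?_⟩
  filter_upwards [ae_restrict_of_ae (measure_eq_zero_iff_ae_notMem.1 hZ),
    ae_restrict_mem measurableSet_Icc] with t htZ ht ξ ζ φ ψ hξ hζ hφ hψ
  exact h t ⟨⟨ht.1, le_max_of_le_left ht.2⟩, htZ⟩ ξ ζ φ ψ (le_max_of_le_left hξ)
    (le_max_of_le_left hζ) (le_max_of_le_left hφ) (le_max_of_le_left hψ)

theorem LipschitzCaratheodory.exists_ae_norm_zero_le (hf : LipschitzCaratheodory τ f) (T : ℝ) :
    ∃ C : ℝ, ∀ᵐ t ∂volume.restrict (Icc 0 T), ‖f t 0 0‖ ≤ C := by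
  obtain ⟨C, hC⟩ := hf.bounded_zero (max T 1) (by positivity)
  exact ⟨C, ae_restrict_of_ae_restrict_of_subset (Icc_subset_Icc_right (le_max_left T 1)) hC⟩

theorem LipschitzCaratheodory.exists_pathRHS_lipschitz (hf : LipschitzCaratheodory τ f)
    (hτ : ∀ i, τ i ∈ Icc 0 Δ) (R T : ℝ) :
    ∃ L : ℝ≥0, ∀ t₀ ≥ 0, ∀ φ : LInf n Δ, ‖φ‖ ≤ R → ∀ x y : ℝ → Fin n → ℝ,
      ContinuousOn x (Icc t₀ T) → ContinuousOn y (Icc t₀ T) →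
      (∀ t ∈ Icc t₀ T, ‖x t‖ ≤ R) → (∀ t ∈ Icc t₀ T, ‖y t‖ ≤ R) →
      ∀ᵐ s ∂volume.restrict (Icc t₀ T), ∀ C, (∀ u ∈ Icc t₀ s, ‖x u - y u‖ ≤ C) →
        ‖pathRHS τ f (concat t₀ φ x) s - pathRHS τ f (concat t₀ φ y) s‖ ≤ L * C := by
  obtain ⟨L, hL⟩ := hf.exists_ae_lipschitz R T
  refine ⟨L, fun t₀ ht₀ φ hφ x y hx hy hxR hyR => ?_⟩
  filter_upwards [ae_restrict_of_ae_restrict_of_subset (Icc_subset_Icc_left ht₀.le) hL,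
    ae_norm_delayed_le hτ hφ hxR, ae_norm_delayed_le hτ hφ hyR,
    ae_restrict_mem measurableSet_Icc] with s hs hxs hys hmem C hC
  refine (hs _ _ _ _ hxs hys (norm_history_le hφ hx hxR hmem)
    (norm_history_le hφ hy hyR hmem)).trans ?_
  gcongr
  have hC₀ : 0 ≤ C := (norm_nonneg _).trans (hC s (right_mem_Icc.2 hmem.1))
  exact max_le (norm_delayed_sub_le (fun i => (hτ i).1) hC₀ hC)
    (norm_history_sub_le hx hy hmem hC)

theorem LipschitzCaratheodory.exists_ae_norm_pathRHS_le (hf : LipschitzCaratheodory τ f)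
    (hτ : ∀ i, τ i ∈ Icc 0 Δ) (R T : ℝ) :
    ∃ B, ∀ t₀ ≥ 0, ∀ φ : LInf n Δ, ‖φ‖ ≤ R → ∀ x : ℝ → Fin n → ℝ,
      ContinuousOn x (Icc t₀ T) → (∀ t ∈ Icc t₀ T, ‖x t‖ ≤ R) →
      ∀ᵐ s ∂volume.restrict (Icc t₀ T), ‖pathRHS τ f (concat t₀ φ x) s‖ ≤ B := by
  obtain ⟨L, hL⟩ := hf.exists_ae_lipschitz R T
  obtain ⟨C, hC⟩ := hf.exists_ae_norm_zero_le T
  refine ⟨L * R + C, fun t₀ ht₀ φ hφ x hx hxR => ?_⟩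
  have hR : 0 ≤ R := (norm_nonneg _).trans hφ
  have hsub := Icc_subset_Icc_left (b := T) ht₀
  filter_upwards [ae_restrict_of_ae_restrict_of_subset hsub hL,
    ae_restrict_of_ae_restrict_of_subset hsub hC, ae_norm_delayed_le hτ hφ hxR,
    ae_restrict_mem measurableSet_Icc] with s hLs hCs hxs hmem
  set η := delayed τ (concat t₀ φ x) s
  set ψ := history Δ (concat t₀ φ x) s
  have hψ : ‖ψ‖ ≤ R := norm_history_le hφ hx hxR hmem
  calc ‖f s η ψ‖ ≤ ‖f s η ψ - f s 0 0‖ + ‖f s 0 0‖ := norm_le_norm_sub_add _ _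
    _ ≤ L * max ‖η - 0‖ ‖ψ - 0‖ + C :=
        add_le_add (hLs η 0 ψ 0 hxs (by simpa using hR) hψ (by simpa using hR)) hCs
    _ ≤ L * R + C := by
        rw [sub_zero, sub_zero]
        gcongr
        exact max_le hxs hψ

theorem LipschitzCaratheodory.integrableOn_pathRHS (hf : LipschitzCaratheodory τ f)
    (hτ : ∀ i, τ i ∈ Icc 0 Δ) (ht₀ : 0 ≤ t₀) (φ : LInf n Δ) {x : ℝ → Fin n → ℝ}
    (hx : ContinuousOn x (Icc t₀ T)) : IntegrableOn (pathRHS τ f (concat t₀ φ x)) (Icc t₀ T) := by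
  rcases le_or_gt T t₀ with hT | hT
  · exact IntegrableOn.of_measure_zero (by simp [hT])
  obtain ⟨R, hφ, hxR⟩ := exists_common_bound φ hx
  obtain ⟨B, hB⟩ := hf.exists_ae_norm_pathRHS_le hτ R T
  exact Integrable.of_bound (hf.measurable t₀ ht₀ T hT φ x (Lp.memLp φ) hx) B
    (hB t₀ ht₀ φ hφ x hx hxR)

end Trajectories

section Truncation

/-- The componentwise truncation of a vector to the cube `[-N, N]^ι`. -/
def clamp {ι : Type*} (N : ℝ) (v : ι → ℝ) : ι → ℝ := fun i => max (-N) (min N (v i))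

section Clamp

variable {ι : Type*} [Fintype ι] {N : ℝ}

theorem norm_clamp_le (hN : 0 ≤ N) (v : ι → ℝ) : ‖clamp N v‖ ≤ N :=
  (pi_norm_le_iff_of_nonneg hN).2 fun _ =>
    abs_le.2 ⟨le_max_left _ _, max_le (by linarith) (min_le_left _ _)⟩

theorem clamp_eq_self {v : ι → ℝ} (h : ‖v‖ ≤ N) : clamp N v = v := by
  funext i
  obtain ⟨hlo, hhi⟩ := abs_le.1 ((norm_le_pi_norm v i).trans h)
  rw [clamp, min_eq_right hhi, max_eq_right hlo]

theorem lipschitzWith_clamp (N : ℝ) : LipschitzWith 1 (clamp N : (ι → ℝ) → ι → ℝ) :=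
  LipschitzWith.of_dist_le_mul fun v w => by
    rw [NNReal.coe_one, one_mul]
    refine (dist_pi_le_iff dist_nonneg).2 fun i => ?_
    have hcoord : LipschitzWith 1 fun v : ι → ℝ => clamp N v i :=
      ((LipschitzWith.eval i).const_min N).const_max (-N)
    simpa only [NNReal.coe_one, one_mul] using hcoord.dist_le_mul v w

end Clamp

variable {n ℓ : ℕ} {Δ : ℝ} {τ : Fin (ℓ + 1) → ℝ} {f : RHS n ℓ Δ} {t₀ b N : ℝ} {ξ : Fin n → ℝ}
  {φ : LInf n Δ} {x : ℝ → Fin n → ℝ}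

/-- The right-hand side along the path that starts with the history `φ` and continues with the
truncation of `x` at the level `N`. It is globally Lipschitz in `x`. -/
def clampedRHS (τ : Fin (ℓ + 1) → ℝ) (f : RHS n ℓ Δ) (t₀ : ℝ) (φ : LInf n Δ) (N : ℝ)
    (x : ℝ → Fin n → ℝ) : ℝ → Fin n → ℝ :=
  pathRHS τ f (concat t₀ φ (clamp N ∘ x))

/-- `x` is continuous and satisfies the integral equation on the compact interval `[t₀, b]`. -/
def IsSolOn (τ : Fin (ℓ + 1) → ℝ) (f : RHS n ℓ Δ) (t₀ b : ℝ) (ξ : Fin n → ℝ) (φ : LInf n Δ)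
    (x : ℝ → Fin n → ℝ) : Prop :=
  IsIntegralSolution (fun x => pathRHS τ f (concat t₀ φ x)) t₀ b ξ x

theorem LipschitzCaratheodory.exists_retardedLipschitz_clampedRHS
    (hf : LipschitzCaratheodory τ f) (hτ : ∀ i, τ i ∈ Icc 0 Δ) (N b : ℝ) :
    ∃ L : ℝ≥0, ∀ t₀ ≥ 0, ∀ φ : LInf n Δ, ‖φ‖ ≤ N →
      RetardedLipschitz t₀ b L (clampedRHS τ f t₀ φ N) := by
  obtain ⟨L, hL⟩ := hf.exists_pathRHS_lipschitz hτ N b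
  have hclamp : ∀ {t₀} {x : ℝ → Fin n → ℝ}, ContinuousOn x (Icc t₀ b) →
      ContinuousOn (clamp N ∘ x) (Icc t₀ b) := fun hx =>
    (lipschitzWith_clamp N).continuous.comp_continuousOn hx
  refine ⟨L, fun t₀ ht₀ φ hφ => ⟨fun x hx => hf.integrableOn_pathRHS hτ ht₀ φ (hclamp hx),
    fun x y hx hy => ?_⟩⟩
  have hN : 0 ≤ N := (norm_nonneg _).trans hφ
  filter_upwards [hL t₀ ht₀ φ hφ _ _ (hclamp hx) (hclamp hy) (fun t _ => norm_clamp_le hN (x t))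
    fun t _ => norm_clamp_le hN (y t)] with s hs C hC
  exact hs C fun u hu => ((lipschitzWith_clamp N).norm_sub_le (x u) (y u)).trans
    (by simpa only [NNReal.coe_one, one_mul] using hC u hu)

theorem integral_clampedRHS (hτ : ∀ i, τ i ∈ Icc 0 Δ) (hN : ∀ t ∈ Icc t₀ b, ‖x t‖ ≤ N) {t : ℝ}
    (ht : t ∈ Icc t₀ b) :
    ∫ s in t₀..t, clampedRHS τ f t₀ φ N x s = ∫ s in t₀..t, pathRHS τ f (concat t₀ φ x) s :=
  integral_pathRHS_congr hτ ht.1 fun u hu => clamp_eq_self (hN u ⟨hu.1, hu.2.trans ht.2⟩)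

theorem isIntegralSolution_clampedRHS_iff (hτ : ∀ i, τ i ∈ Icc 0 Δ)
    (hN : ∀ t ∈ Icc t₀ b, ‖x t‖ ≤ N) :
    IsIntegralSolution (clampedRHS τ f t₀ φ N) t₀ b ξ x ↔ IsSolOn τ f t₀ b ξ φ x :=
  ⟨fun h => ⟨h.continuousOn, fun t ht => by
      rw [h.equation t ht, integral_clampedRHS hτ hN ht]⟩,
    fun h => ⟨h.continuousOn, fun t ht => by
      rw [h.equation t ht, integral_clampedRHS hτ hN ht]⟩⟩

end Truncation

section WellPosedness

theorem exists_gt_forall_norm_le {E : Type*} [NormedAddCommGroup E] {z : ℝ → E} {a b c N : ℝ}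
    (hab : a ≤ b) (hbc : b < c) (hz : ContinuousOn z (Icc a c)) (h : ∀ t ∈ Icc a b, ‖z t‖ < N) :
    ∃ d ∈ Ioc b c, ∀ t ∈ Icc a d, ‖z t‖ ≤ N := by
  have hcont : ContinuousWithinAt z (Ici b) b :=
    (hz b ⟨hab, hbc.le⟩).mono_of_mem_nhdsWithin (Icc_mem_nhdsGE_of_mem ⟨hab, hbc⟩)
  obtain ⟨d, hbd, hd⟩ := mem_nhdsGE_iff_exists_Icc_subset.1
    (hcont.norm.eventually_lt_const (h b (right_mem_Icc.2 hab)))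
  refine ⟨min d c, ⟨lt_min hbd hbc, min_le_right _ _⟩, fun t ht => ?_⟩
  rcases le_total t b with htb | hbt
  · exact (h t ⟨ht.1, htb⟩).le
  · exact (hd ⟨hbt, ht.2.trans (min_le_left _ _)⟩ : ‖z t‖ < N).le

variable {n ℓ : ℕ} {Δ : ℝ} {τ : Fin (ℓ + 1) → ℝ} {f : RHS n ℓ Δ} {t₀ b : ℝ} {ξ : Fin n → ℝ}
  {φ : LInf n Δ} {x y z : ℝ → Fin n → ℝ} {J : Set ℝ}

theorem IsSolOn.mono (hx : IsSolOn τ f t₀ b ξ φ x) {c : ℝ} (hc : c ≤ b) :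
    IsSolOn τ f t₀ c ξ φ x :=
  IsIntegralSolution.mono hx hc

theorem IsSolOn.congr (hτ : ∀ i, τ i ∈ Icc 0 Δ) (hx : IsSolOn τ f t₀ b ξ φ x)
    (hxy : EqOn x y (Icc t₀ b)) : IsSolOn τ f t₀ b ξ φ y :=
  ⟨hx.continuousOn.congr hxy.symm, fun t ht => by
    rw [← hxy ht, hx.equation t ht,
      integral_pathRHS_congr hτ ht.1 (hxy.mono (Icc_subset_Icc_right ht.2))]⟩

theorem IsSolOn.eqOn (hf : LipschitzCaratheodory τ f) (hτ : ∀ i, τ i ∈ Icc 0 Δ) (ht₀ : 0 ≤ t₀)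
    (hx : IsSolOn τ f t₀ b ξ φ x) (hy : IsSolOn τ f t₀ b ξ φ y) : EqOn x y (Icc t₀ b) := by
  obtain ⟨N₁, hφ, hxN⟩ := exists_common_bound φ hx.continuousOn
  obtain ⟨N₂, -, hyN⟩ := exists_common_bound φ hy.continuousOn
  obtain ⟨L, hL⟩ := hf.exists_retardedLipschitz_clampedRHS hτ (max N₁ N₂) b
  exact (hL t₀ ht₀ φ (le_max_of_le_left hφ)).eqOn
    ((isIntegralSolution_clampedRHS_iff hτ fun t ht => le_max_of_le_left (hxN t ht)).2 hx)
    ((isIntegralSolution_clampedRHS_iff hτ fun t ht => le_max_of_le_right (hyN t ht)).2 hy)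

theorem IsSolOn.exists_gt (hf : LipschitzCaratheodory τ f) (hτ : ∀ i, τ i ∈ Icc 0 Δ)
    (ht₀ : 0 ≤ t₀) (htb : t₀ ≤ b) (hx : IsSolOn τ f t₀ b ξ φ x) :
    ∃ c > b, ∃ z, IsSolOn τ f t₀ c ξ φ z := by
  obtain ⟨N, hφ, hxN⟩ := exists_common_bound φ hx.continuousOn
  have hNlt : N < N + 1 := lt_add_one N
  have hblt : b < b + 1 := lt_add_one b
  obtain ⟨L, hL⟩ := hf.exists_retardedLipschitz_clampedRHS hτ (N + 1) (b + 1)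
  obtain ⟨z, hz⟩ := (hL t₀ ht₀ φ (hφ.trans hNlt.le)).exists_isIntegralSolution
    (htb.trans hblt.le) ξ
  obtain ⟨L', hL'⟩ := hf.exists_retardedLipschitz_clampedRHS hτ (N + 1) b
  have hx' := (isIntegralSolution_clampedRHS_iff hτ fun t ht => (hxN t ht).trans hNlt.le).2 hx
  have hzx : EqOn z x (Icc t₀ b) :=
    (hL' t₀ ht₀ φ (hφ.trans hNlt.le)).eqOn (hz.mono hblt.le) hx'
  obtain ⟨c, hc, hzc⟩ := exists_gt_forall_norm_le htb hblt hz.continuousOn fun t ht => by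
    rw [hzx ht]
    exact (hxN t ht).trans_lt hNlt
  exact ⟨c, hc.1, z, (isIntegralSolution_clampedRHS_iff hτ hzc).1 (hz.mono hc.2)⟩

theorem IsSolOn.absolutelyContinuousOnInterval (hf : LipschitzCaratheodory τ f)
    (hτ : ∀ i, τ i ∈ Icc 0 Δ) (ht₀ : 0 ≤ t₀) (htb : t₀ ≤ b) (hx : IsSolOn τ f t₀ b ξ φ x) :
    AbsolutelyContinuousOnInterval x t₀ b := by
  obtain ⟨R, hφ, hxR⟩ := exists_common_bound φ hx.continuousOn
  obtain ⟨B, hB⟩ := hf.exists_ae_norm_pathRHS_le hτ R b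
  have hbound := (ae_restrict_iff' measurableSet_Icc).1 (hB t₀ ht₀ φ hφ x hx.continuousOn hxR)
  have hint : ∀ t ∈ Icc t₀ b, IntervalIntegrable (pathRHS τ f (concat t₀ φ x)) volume t₀ t :=
    fun t ht => (intervalIntegrable_iff_integrableOn_Icc_of_le ht.1).2
      ((hf.integrableOn_pathRHS hτ ht₀ φ hx.continuousOn).mono_set (Icc_subset_Icc_right ht.2))
  refine LipschitzOnWith.absolutelyContinuousOnInterval (K := B.toNNReal) ?_
  rw [uIcc_of_le htb]
  refine LipschitzOnWith.of_dist_le_mul fun s hs t ht => ?_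
  rw [dist_eq_norm, hx.equation s hs, hx.equation t ht, add_sub_add_left_eq_sub,
    intervalIntegral.integral_interval_sub_left (hint s hs) (hint t ht), Real.dist_eq]
  refine intervalIntegral.norm_integral_le_of_norm_le_const_ae ?_
  filter_upwards [hbound] with u hu hmem
  exact (hu (uIcc_subset_Icc ht hs (uIoc_subset_uIcc hmem))).trans (Real.le_coe_toNNReal B)

theorem IsForwardInterval.left_le (hJ : IsForwardInterval t₀ J) {t : ℝ} (ht : t ∈ J) :
    t₀ ≤ t := by
  obtain ⟨b, -, rfl | rfl⟩ := hJ <;> exact ht.1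

theorem IsForwardInterval.mem_of_le (hJ : IsForwardInterval t₀ J) {s t : ℝ} (hs : t₀ ≤ s)
    (hst : s ≤ t) (ht : t ∈ J) : s ∈ J := by
  have hst' : (s : EReal) ≤ t := EReal.coe_le_coe_iff.2 hst
  obtain ⟨b, -, rfl | rfl⟩ := hJ
  · exact ⟨hs, hst'.trans_lt ht.2⟩
  · exact ⟨hs, hst'.trans ht.2⟩

theorem isSolution_iff (hf : LipschitzCaratheodory τ f) (hτ : ∀ i, τ i ∈ Icc 0 Δ)
    (ht₀ : 0 ≤ t₀) :
    IsSolution τ f t₀ ξ φ J x ↔ IsForwardInterval t₀ J ∧ ∀ b ∈ J, IsSolOn τ f t₀ b ξ φ x := by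
  refine ⟨fun h => ⟨h.interval, fun b hb => ⟨?_, fun t ht => ?_⟩⟩, fun ⟨hJ, h⟩ =>
    ⟨hJ, fun t ht => ?_, fun t ht => ?_, fun t ht => ?_⟩⟩
  · rw [← uIcc_of_le (h.interval.left_le hb)]
    exact (h.locallyAC b hb).continuousOn
  · exact h.equation t (h.interval.mem_of_le ht.1 ht.2 hb)
  · exact (h t ht).absolutelyContinuousOnInterval hf hτ ht₀ (hJ.left_le ht)
  · exact (intervalIntegrable_iff_integrableOn_Icc_of_le (hJ.left_le ht)).2
      (hf.integrableOn_pathRHS hτ ht₀ φ (h t ht).continuousOn)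
  · exact (h t ht).equation t (right_mem_Icc.2 (hJ.left_le ht))

/-- The right end `T_{(t₀, ξ, φ)}` of the maximal interval of existence, as the supremum of the
`b` for which there is a solution on `[t₀, b]`. -/
def lifespan (τ : Fin (ℓ + 1) → ℝ) (f : RHS n ℓ Δ) (t₀ : ℝ) (ξ : Fin n → ℝ) (φ : LInf n Δ) :
    EReal :=
  sSup ((↑) '' {b : ℝ | t₀ ≤ b ∧ ∃ x, IsSolOn τ f t₀ b ξ φ x})

theorem coe_lt_lifespan_iff (hf : LipschitzCaratheodory τ f) (hτ : ∀ i, τ i ∈ Icc 0 Δ)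
    (ht₀ : 0 ≤ t₀) (htb : t₀ ≤ b) :
    (b : EReal) < lifespan τ f t₀ ξ φ ↔ ∃ x, IsSolOn τ f t₀ b ξ φ x := by
  constructor
  · intro hb
    obtain ⟨-, ⟨c, ⟨-, x, hx⟩, rfl⟩, hbc⟩ := lt_sSup_iff.1 hb
    exact ⟨x, hx.mono (EReal.coe_lt_coe_iff.1 hbc).le⟩
  · rintro ⟨x, hx⟩
    obtain ⟨c, hc, z, hz⟩ := hx.exists_gt hf hτ ht₀ htb
    exact (EReal.coe_lt_coe_iff.2 hc).trans_le
      (le_sSup (mem_image_of_mem _ ⟨htb.trans hc.le, z, hz⟩))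

theorem isForwardInterval_halfOpen_lifespan (hf : LipschitzCaratheodory τ f)
    (hτ : ∀ i, τ i ∈ Icc 0 Δ) (ht₀ : 0 ≤ t₀) (ξ : Fin n → ℝ) (φ : LInf n Δ) :
    IsForwardInterval t₀ (halfOpen t₀ (lifespan τ f t₀ ξ φ)) := by
  refine ⟨_, (coe_lt_lifespan_iff hf hτ ht₀ le_rfl).2 ⟨fun _ => ξ, continuousOn_const, ?_⟩,
    Or.inl rfl⟩
  intro t ht
  rw [le_antisymm ht.2 ht.1, intervalIntegral.integral_same, add_zero]

theorem exists_forall_isSolOn_halfOpen_lifespan (hf : LipschitzCaratheodory τ f)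
    (hτ : ∀ i, τ i ∈ Icc 0 Δ) (ht₀ : 0 ≤ t₀) (ξ : Fin n → ℝ) (φ : LInf n Δ) :
    ∃ x, ∀ b ∈ halfOpen t₀ (lifespan τ f t₀ ξ φ), IsSolOn τ f t₀ b ξ φ x := by
  have hex : ∀ b ∈ halfOpen t₀ (lifespan τ f t₀ ξ φ), ∃ x, IsSolOn τ f t₀ b ξ φ x := fun b hb =>
    (coe_lt_lifespan_iff hf hτ ht₀ hb.1).1 hb.2
  choose! X hX using hex
  refine ⟨fun t => X t t, fun b hb => (hX b hb).congr hτ fun t ht => ?_⟩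
  have htmem := (isForwardInterval_halfOpen_lifespan hf hτ ht₀ ξ φ).mem_of_le ht.1 ht.2 hb
  exact ((hX b hb).mono ht.2).eqOn hf hτ ht₀ (hX t htmem) (right_mem_Icc.2 ht.1)

theorem IsSolution.subset_halfOpen_lifespan (hf : LipschitzCaratheodory τ f)
    (hτ : ∀ i, τ i ∈ Icc 0 Δ) (ht₀ : 0 ≤ t₀) (hx : IsSolution τ f t₀ ξ φ J x) :
    J ⊆ halfOpen t₀ (lifespan τ f t₀ ξ φ) := fun b hb => by
  obtain ⟨hJ, h⟩ := (isSolution_iff hf hτ ht₀).1 hx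
  exact ⟨hJ.left_le hb, (coe_lt_lifespan_iff hf hτ ht₀ (hJ.left_le hb)).2 ⟨x, h b hb⟩⟩

theorem IsSolution.eqOn (hf : LipschitzCaratheodory τ f) (hτ : ∀ i, τ i ∈ Icc 0 Δ)
    (ht₀ : 0 ≤ t₀) (hx : IsSolution τ f t₀ ξ φ J x)
    (hy : ∀ b ∈ J, IsSolOn τ f t₀ b ξ φ y) : EqOn x y J := fun t ht => by
  obtain ⟨hJ, h⟩ := (isSolution_iff hf hτ ht₀).1 hx
  exact (h t ht).eqOn hf hτ ht₀ (hy t ht) (right_mem_Icc.2 (hJ.left_le ht))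

theorem isMaximalSolution_iff (hf : LipschitzCaratheodory τ f) (hτ : ∀ i, τ i ∈ Icc 0 Δ)
    (ht₀ : 0 ≤ t₀) : IsMaximalSolution τ f t₀ ξ φ J x ↔
      J = halfOpen t₀ (lifespan τ f t₀ ξ φ) ∧ ∀ b ∈ J, IsSolOn τ f t₀ b ξ φ x := by
  constructor
  · rintro ⟨hx, hmax⟩
    obtain ⟨y, hy⟩ := exists_forall_isSolOn_halfOpen_lifespan hf hτ ht₀ ξ φ
    have hsub := hx.subset_halfOpen_lifespan hf hτ ht₀
    have hy' := (isSolution_iff hf hτ ht₀).2 ⟨isForwardInterval_halfOpen_lifespan hf hτ ht₀ ξ φ, hy⟩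
    exact ⟨(hmax _ y hy' hsub (hx.eqOn hf hτ ht₀ fun b hb => hy b (hsub hb))).symm,
      ((isSolution_iff hf hτ ht₀).1 hx).2⟩
  · rintro ⟨rfl, hx⟩
    exact ⟨(isSolution_iff hf hτ ht₀).2 ⟨isForwardInterval_halfOpen_lifespan hf hτ ht₀ ξ φ, hx⟩,
      fun J' y hy hJ' _ => (hy.subset_halfOpen_lifespan hf hτ ht₀).antisymm hJ'⟩

theorem exists_isMaximalSolution_unique (hf : LipschitzCaratheodory τ f)
    (hτ : ∀ i, τ i ∈ Icc 0 Δ) (ht₀ : 0 ≤ t₀) (ξ : Fin n → ℝ) (φ : LInf n Δ) :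
    ∃ (Tx : EReal) (x : ℝ → Fin n → ℝ), IsMaximalSolution τ f t₀ ξ φ (halfOpen t₀ Tx) x ∧
      ∀ (J : Set ℝ) (y : ℝ → Fin n → ℝ), IsMaximalSolution τ f t₀ ξ φ J y →
        J = halfOpen t₀ Tx ∧ EqOn y x J := by
  obtain ⟨x, hx⟩ := exists_forall_isSolOn_halfOpen_lifespan hf hτ ht₀ ξ φ
  refine ⟨lifespan τ f t₀ ξ φ, x, (isMaximalSolution_iff hf hτ ht₀).2 ⟨rfl, hx⟩, fun J y hy => ?_⟩
  obtain ⟨hJ, -⟩ := (isMaximalSolution_iff hf hτ ht₀).1 hy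
  exact ⟨hJ, hy.1.eqOn hf hτ ht₀ (hJ ▸ hx)⟩

end WellPosedness

section WeakStarCompactness

variable {α ι : Type*} [MeasurableSpace α] [Fintype ι] {μ : Measure α} {R : ℝ}

theorem norm_dotProduct_le (v w : ι → ℝ) : ‖v ⬝ᵥ w‖ ≤ Fintype.card ι * (‖v‖ * ‖w‖) := by
  have hterm : ∀ i ∈ Finset.univ, ‖v i * w i‖ ≤ ‖v‖ * ‖w‖ := fun i _ =>
    (norm_mul _ _).trans_le (by gcongr <;> exact norm_le_pi_norm _ i)
  simpa [dotProduct] using (norm_sum_le _ _).trans (Finset.sum_le_sum hterm)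

theorem norm_dotProduct_le_of_norm_le (v : ι → ℝ) {w : ι → ℝ} (hw : ‖w‖ ≤ R) :
    ‖v ⬝ᵥ w‖ ≤ Fintype.card ι * R * ‖v‖ :=
  calc ‖v ⬝ᵥ w‖ ≤ Fintype.card ι * (‖v‖ * ‖w‖) := norm_dotProduct_le v w
    _ ≤ Fintype.card ι * (‖v‖ * R) := by gcongr
    _ = Fintype.card ι * R * ‖v‖ := by ring

theorem integrable_dotProduct_of_ae_norm_le {g h : α → ι → ℝ} (hg : Integrable g μ)
    (hh : AEStronglyMeasurable h μ) (hR : ∀ᵐ s ∂μ, ‖h s‖ ≤ R) :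
    Integrable (fun s => g s ⬝ᵥ h s) μ := by
  have hmeas : AEStronglyMeasurable (fun s => g s ⬝ᵥ h s) μ :=
    (continuous_fst.dotProduct continuous_snd).comp_aestronglyMeasurable
      (hg.aestronglyMeasurable.prodMk hh)
  refine (hg.norm.const_mul (Fintype.card ι * R)).mono' hmeas ?_
  filter_upwards [hR] with s hs using norm_dotProduct_le_of_norm_le (g s) hs

theorem norm_integral_dotProduct_le {g h : α → ι → ℝ} (hg : Integrable g μ)
    (hR : ∀ᵐ s ∂μ, ‖h s‖ ≤ R) :
    ‖∫ s, g s ⬝ᵥ h s ∂μ‖ ≤ Fintype.card ι * R * ∫ s, ‖g s‖ ∂μ := by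
  rw [← integral_const_mul]
  refine norm_integral_le_of_norm_le (hg.norm.const_mul _) ?_
  filter_upwards [hR] with s hs using norm_dotProduct_le_of_norm_le (g s) hs

theorem exists_subseq_tendsto_inner {E : Type*} [NormedAddCommGroup E] [InnerProductSpace ℝ E]
    [CompleteSpace E] [TopologicalSpace.SeparableSpace E] {u : ℕ → E} {C : ℝ}
    (hu : ∀ k, ‖u k‖ ≤ C) :
    ∃ (σ : ℕ → ℕ) (w : E), StrictMono σ ∧
      ∀ v, Tendsto (fun k => inner ℝ (u (σ k)) v) atTop (𝓝 (inner ℝ w v)) := by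
  have hball : ∀ k, StrongDual.toWeakDual (InnerProductSpace.toDual ℝ E (u k)) ∈
      WeakDual.toStrongDual ⁻¹' Metric.closedBall (0 : StrongDual ℝ E) C := fun k =>
    mem_closedBall_zero_iff.2 (((InnerProductSpace.toDual ℝ E).norm_map (u k)).trans_le (hu k))
  obtain ⟨Λ, -, σ, hσ, hlim⟩ := WeakDual.isSeqCompact_closedBall ℝ E 0 C hball
  refine ⟨σ, (InnerProductSpace.toDual ℝ E).symm (WeakDual.toStrongDual Λ), hσ, fun v => ?_⟩
  rw [InnerProductSpace.toDual_symm_apply]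
  exact ((WeakDual.eval_continuous v).tendsto Λ).comp hlim

theorem integral_dotProduct_eq_inner {g h : α → ι → ℝ} {u v : Lp (EuclideanSpace ℝ ι) 2 μ}
    (hu : u =ᵐ[μ] fun s => WithLp.toLp 2 (h s)) (hv : v =ᵐ[μ] fun s => WithLp.toLp 2 (g s)) :
    ∫ s, g s ⬝ᵥ h s ∂μ = inner ℝ u v := by
  rw [L2.inner_def]
  refine integral_congr_ae ?_
  filter_upwards [hu, hv] with s hus hvs
  rw [hus, hvs, EuclideanSpace.inner_toLp_toLp, star_trivial]

theorem exists_subseq_tendsto_integral_dotProduct [IsFiniteMeasure μ] [IsSeparable μ]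
    {ψ : ℕ → α → ι → ℝ} (hψ : ∀ k, AEStronglyMeasurable (ψ k) μ)
    (hR : ∀ k, ∀ᵐ s ∂μ, ‖ψ k s‖ ≤ R) :
    ∃ (σ : ℕ → ℕ) (h : α → ι → ℝ), StrictMono σ ∧ MemLp h 2 μ ∧
      ∀ g : α → ι → ℝ, MemLp g 2 μ →
        Tendsto (fun k => ∫ s, g s ⬝ᵥ ψ (σ k) s ∂μ) atTop (𝓝 (∫ s, g s ⬝ᵥ h s ∂μ)) := by
  let A : EuclideanSpace ℝ ι ≃L[ℝ] (ι → ℝ) := EuclideanSpace.equiv ι ℝ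
  have hA {g : α → ι → ℝ} (hg : MemLp g 2 μ) : MemLp (fun s => A.symm (g s)) 2 μ :=
    A.symm.toContinuousLinearMap.comp_memLp' hg
  have hmem : ∀ k, MemLp (ψ k) 2 μ := fun k => MemLp.of_bound (hψ k) R (hR k)
  let u : ℕ → Lp (EuclideanSpace ℝ ι) 2 μ := fun k => (hA (hmem k)).toLp
  have hu : ∀ k, ‖u k‖ ≤ _ := fun k => by
    refine Lp.norm_le_of_ae_bound (C := ‖A.symm.toContinuousLinearMap‖ * |R|) (by positivity) ?_
    filter_upwards [(hA (hmem k)).coeFn_toLp, hR k] with s hs hsR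
    rw [hs]
    exact A.symm.toContinuousLinearMap.le_opNorm_of_le (hsR.trans (le_abs_self R))
  have : Fact ((2 : ℝ≥0∞) ≠ ∞) := ⟨ENNReal.ofNat_ne_top⟩
  obtain ⟨σ, w, hσ, hw⟩ := exists_subseq_tendsto_inner hu
  refine ⟨σ, fun s => A (w s), hσ, A.toContinuousLinearMap.comp_memLp' (Lp.memLp w),
    fun g hg => ?_⟩
  have hlim : w =ᵐ[μ] fun s => A.symm (A (w s)) := .rfl
  rw [integral_dotProduct_eq_inner hlim (hA hg).coeFn_toLp]
  simp only [fun k => integral_dotProduct_eq_inner (hA (hmem k)).coeFn_toLp (hA hg).coeFn_toLp]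
  exact hw _

theorem ae_le_of_tendsto_setIntegral [IsFiniteMeasure μ] {u : ℕ → α → ℝ} {v : α → ℝ}
    (hu : ∀ k, Integrable (u k) μ) (hv : Integrable v μ) (hR : ∀ k, ∀ᵐ s ∂μ, u k s ≤ R)
    (hlim : ∀ A, MeasurableSet A →
      Tendsto (fun k => ∫ s in A, u k s ∂μ) atTop (𝓝 (∫ s in A, v s ∂μ))) :
    ∀ᵐ s ∂μ, v s ≤ R :=
  ae_le_of_forall_setIntegral_le hv (integrable_const R) fun A hA _ =>
    le_of_tendsto' (hlim A hA) fun k =>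
      integral_mono_ae (hu k).restrict (integrable_const R) (ae_restrict_of_ae (hR k))

theorem ae_norm_le_of_tendsto_integral_dotProduct [IsFiniteMeasure μ] {ψ : ℕ → α → ι → ℝ}
    {h : α → ι → ℝ} (hR₀ : 0 ≤ R) (hψ : ∀ k, Integrable (ψ k) μ) (hh : Integrable h μ)
    (hR : ∀ k, ∀ᵐ s ∂μ, ‖ψ k s‖ ≤ R)
    (hlim : ∀ g : α → ι → ℝ, MemLp g 2 μ →
      Tendsto (fun k => ∫ s, g s ⬝ᵥ ψ k s ∂μ) atTop (𝓝 (∫ s, g s ⬝ᵥ h s ∂μ))) :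
    ∀ᵐ s ∂μ, ‖h s‖ ≤ R := by
  classical
  have hcoord : ∀ (i : ι) (c : ℝ), |c| = 1 → ∀ᵐ s ∂μ, c * h s i ≤ R := fun i c hc => by
    refine ae_le_of_tendsto_setIntegral (fun k => ((hψ k).eval i).const_mul c)
      ((hh.eval i).const_mul c) (fun k => ?_) fun A hA => ?_
    · filter_upwards [hR k] with s hs
      calc c * ψ k s i ≤ |c * ψ k s i| := le_abs_self _
        _ = ‖ψ k s i‖ := by rw [abs_mul, hc, one_mul, Real.norm_eq_abs]
        _ ≤ R := (norm_le_pi_norm _ i).trans hs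
    · have htest : ∀ w : α → ι → ℝ, ∫ s, A.indicator (fun _ => Pi.single i c) s ⬝ᵥ w s ∂μ =
          ∫ s in A, c * w s i ∂μ := fun w => by
        rw [← integral_indicator hA]
        refine integral_congr_ae (Eventually.of_forall fun s => ?_)
        by_cases hs : s ∈ A <;> simp [hs]
      simpa only [htest] using hlim _ ((memLp_const (Pi.single i c)).indicator hA)
  filter_upwards [ae_all_iff.2 fun i => hcoord i 1 (by simp),
    ae_all_iff.2 fun i => hcoord i (-1) (by simp)] with s hpos hneg
  exact (pi_norm_le_iff_of_nonneg hR₀).2 fun i =>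
    abs_le.2 ⟨by linarith [hneg i], by linarith [hpos i]⟩

theorem exists_simpleFunc_integral_norm_sub_lt {E : Type*} [NormedAddCommGroup E] {g : α → E}
    (hg : Integrable g μ) {η : ℝ} (hη : 0 < η) :
    ∃ p : SimpleFunc α E, Integrable p μ ∧ ∫ s, ‖g s - p s‖ ∂μ < η := by
  obtain ⟨p, hgp, hp⟩ := (memLp_one_iff_integrable.2 hg).exists_simpleFunc_eLpNorm_sub_lt
    ENNReal.one_ne_top (ENNReal.ofReal_pos.2 hη).ne'
  have hp' := memLp_one_iff_integrable.1 hp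
  refine ⟨p, hp', ?_⟩
  rw [eLpNorm_one_eq_lintegral_enorm] at hgp
  refine (integral_norm_eq_lintegral_enorm (hg.sub hp').aestronglyMeasurable).trans_lt ?_
  exact (ENNReal.lt_ofReal_iff_toReal_lt hgp.ne_top).1 hgp

theorem exists_simpleFunc_norm_integral_dotProduct_sub_lt {g : α → ι → ℝ} (hg : Integrable g μ)
    (R : ℝ) {ε : ℝ} (hε : 0 < ε) :
    ∃ p : SimpleFunc α (ι → ℝ), ∀ h : α → ι → ℝ, AEStronglyMeasurable h μ →
      (∀ᵐ s ∂μ, ‖h s‖ ≤ R) → ‖∫ s, g s ⬝ᵥ h s ∂μ - ∫ s, p s ⬝ᵥ h s ∂μ‖ < ε := by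
  set C : ℝ := Fintype.card ι * |R|
  obtain ⟨p, hp, hgp⟩ := exists_simpleFunc_integral_norm_sub_lt hg
    (η := ε / (C + 1)) (by positivity)
  refine ⟨p, fun h hh hR => ?_⟩
  rw [← integral_sub (integrable_dotProduct_of_ae_norm_le hg hh hR)
    (integrable_dotProduct_of_ae_norm_le hp hh hR)]
  simp only [← sub_dotProduct]
  calc ‖∫ s, (g s - p s) ⬝ᵥ h s ∂μ‖ ≤ C * ∫ s, ‖g s - p s‖ ∂μ :=
        norm_integral_dotProduct_le (hg.sub hp) (hR.mono fun s hs => hs.trans (le_abs_self R))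
    _ ≤ C * (ε / (C + 1)) := by gcongr
    _ < (C + 1) * (ε / (C + 1)) := by gcongr; exact lt_add_one C
    _ = ε := mul_div_cancel₀ ε (by positivity)

theorem tendsto_integral_dotProduct_of_memLp_two [IsFiniteMeasure μ] {ψ : ℕ → α → ι → ℝ}
    {h : α → ι → ℝ} (hψ : ∀ k, AEStronglyMeasurable (ψ k) μ) (hh : AEStronglyMeasurable h μ)
    (hψR : ∀ k, ∀ᵐ s ∂μ, ‖ψ k s‖ ≤ R) (hhR : ∀ᵐ s ∂μ, ‖h s‖ ≤ R)
    (hlim : ∀ g : α → ι → ℝ, MemLp g 2 μ →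
      Tendsto (fun k => ∫ s, g s ⬝ᵥ ψ k s ∂μ) atTop (𝓝 (∫ s, g s ⬝ᵥ h s ∂μ)))
    {g : α → ι → ℝ} (hg : Integrable g μ) :
    Tendsto (fun k => ∫ s, g s ⬝ᵥ ψ k s ∂μ) atTop (𝓝 (∫ s, g s ⬝ᵥ h s ∂μ)) := by
  refine Metric.tendsto_nhds.2 fun ε hε => ?_
  obtain ⟨p, hp⟩ := exists_simpleFunc_norm_integral_dotProduct_sub_lt hg R
    (show 0 < ε / 3 by positivity)
  filter_upwards [Metric.tendsto_nhds.1 (hlim p (p.memLp_of_isFiniteMeasure 2 μ)) (ε / 3)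
    (by positivity)] with k hk
  have hψk := hp (ψ k) (hψ k) (hψR k)
  have hh' := hp h hh hhR
  rw [← dist_eq_norm] at hψk hh'
  rw [dist_comm] at hh'
  calc dist (∫ s, g s ⬝ᵥ ψ k s ∂μ) (∫ s, g s ⬝ᵥ h s ∂μ) ≤ _ + _ + _ := dist_triangle4 _ _ _ _
    _ < ε / 3 + ε / 3 + ε / 3 := by gcongr
    _ = ε := by ring

theorem exists_subseq_weakStarTendsto {n : ℕ} {Δ : ℝ} {φ : ℕ → LInf n Δ} (hφ : ∀ k, ‖φ k‖ ≤ R) :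
    ∃ (σ : ℕ → ℕ) (φ₀ : LInf n Δ), StrictMono σ ∧ ‖φ₀‖ ≤ R ∧
      WeakStarTendsto (fun k => φ (σ k)) φ₀ := by
  have hR₀ : 0 ≤ R := (norm_nonneg _).trans (hφ 0)
  have hmeas : ∀ k, AEStronglyMeasurable (φ k) (histMeasure Δ) := fun k =>
    Lp.aestronglyMeasurable (φ k)
  have hR : ∀ k, ∀ᵐ s ∂histMeasure Δ, ‖φ k s‖ ≤ R := fun k =>
    (ae_norm_le_norm_lpTop (φ k)).mono fun s hs => hs.trans (hφ k)
  obtain ⟨σ, h, hσ, hh, hlim⟩ := exists_subseq_tendsto_integral_dotProduct hmeas hR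
  have hhR : ∀ᵐ s ∂histMeasure Δ, ‖h s‖ ≤ R :=
    ae_norm_le_of_tendsto_integral_dotProduct hR₀
      (fun k => (Lp.memLp (φ (σ k))).integrable le_top) (hh.integrable one_le_two)
      (fun k => hR (σ k)) hlim
  have hmem : MemLp h ∞ (histMeasure Δ) := memLp_top_of_bound hh.aestronglyMeasurable R hhR
  refine ⟨σ, hmem.toLp h, hσ, norm_lpTop_le_of_ae hR₀ ?_, fun g hg => ?_⟩
  · filter_upwards [hmem.coeFn_toLp, hhR] with s hs hsR
    rwa [hs]
  · have hcongr : ∫ s, g s ⬝ᵥ hmem.toLp h s ∂histMeasure Δ = ∫ s, g s ⬝ᵥ h s ∂histMeasure Δ :=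
      integral_congr_ae (hmem.coeFn_toLp.mono fun s hs => by simp only [hs])
    rw [hcongr]
    exact tendsto_integral_dotProduct_of_memLp_two (fun k => hmeas (σ k))
      hh.aestronglyMeasurable (fun k => hR (σ k)) hhR hlim hg

end WeakStarCompactness

section WeakStarContinuity

variable {n ℓ : ℕ} {Δ : ℝ} {τ : Fin (ℓ + 1) → ℝ} {f : RHS n ℓ Δ} {t₀ T R : ℝ}

theorem setIntegral_Ico_dotProduct_comp_add {ι : Type*} [Fintype ι] {d : ℝ} (hd : 0 ≤ d)
    (g ψ : ℝ → ι → ℝ) :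
    ∫ s in Ico (-Δ) (-d), g s ⬝ᵥ ψ (s + d) =
      ∫ u, (Ico (d - Δ) 0).indicator (fun u => g (u - d)) u ⬝ᵥ ψ u ∂histMeasure Δ := by
  have hsub : Ico (d - Δ) 0 ⊆ Icc (-Δ) 0 := fun u hu => ⟨by linarith [hu.1], hu.2.le⟩
  have hpre : (· + d) ⁻¹' Ico (d - Δ) 0 = Ico (-Δ) (-d) := by
    rw [preimage_add_const_Ico, zero_sub, sub_sub_cancel_left]
  have hind : ∀ u, (Ico (d - Δ) 0).indicator (fun u => g (u - d)) u ⬝ᵥ ψ u =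
      (Ico (d - Δ) 0).indicator (fun u => g (u - d) ⬝ᵥ ψ u) u := fun u => by
    by_cases hu : u ∈ Ico (d - Δ) 0 <;> simp [hu]
  have hshift := (measurePreserving_add_right volume d).setIntegral_preimage_emb
    (measurableEmbedding_addRight d) (fun u => g (u - d) ⬝ᵥ ψ u) (Ico (d - Δ) 0)
  simp only [hpre, add_sub_cancel_right] at hshift
  simp only [hind]
  rw [hshift, setIntegral_indicator measurableSet_Ico, inter_eq_right.2 hsub]

theorem integrable_indicator_Ico_comp_sub {E : Type*} [NormedAddCommGroup E] {g : ℝ → E}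
    (hg : Integrable g (histMeasure Δ)) {d : ℝ} (hd : 0 ≤ d) :
    Integrable ((Ico (d - Δ) 0).indicator fun u => g (u - d)) (histMeasure Δ) := by
  have hshift : IntegrableOn (fun u => g (u - d)) ((· - d) ⁻¹' Icc (-Δ) 0) :=
    ((measurePreserving_sub_right volume d).integrableOn_comp_preimage
      (measurableEmbedding_subRight d)).2 hg
  refine ((integrable_indicator_iff measurableSet_Ico).2 (hshift.mono_set ?_)).restrict
  exact fun u hu => ⟨by linarith [hu.1], by linarith [hu.2]⟩

theorem integral_dotProduct_history (ψ : LInf n Δ) {x : ℝ → Fin n → ℝ}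
    (hx : ContinuousOn x (Icc t₀ T)) {t : ℝ} (ht : t ∈ Icc t₀ T) {g : ℝ → Fin n → ℝ}
    (hg : Integrable g (histMeasure Δ)) :
    ∫ s, g s ⬝ᵥ history Δ (concat t₀ ψ x) t s ∂histMeasure Δ =
      ∫ u, (Ico (t - t₀ - Δ) 0).indicator (fun u => g (u - (t - t₀))) u ⬝ᵥ ψ u ∂histMeasure Δ +
        ∫ s in Icc (-Δ) 0 \ Iio (-(t - t₀)), g s ⬝ᵥ x (t + s) := by
  have hae : (fun s => g s ⬝ᵥ history Δ (concat t₀ ψ x) t s) =ᵐ[histMeasure Δ]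
      fun s => g s ⬝ᵥ concat t₀ ψ x (t + s) :=
    (history_ae_eq (Lp.memLp ψ) hx ht).mono fun s hs => by simp only [hs]
  have hint : IntegrableOn (fun s => g s ⬝ᵥ concat t₀ ψ x (t + s)) (Icc (-Δ) 0) :=
    (integrable_congr hae).1 (integrable_dotProduct_of_ae_norm_le hg
      (Lp.aestronglyMeasurable _) (ae_norm_le_norm_lpTop _))
  have hinter : Icc (-Δ) 0 ∩ Iio (-(t - t₀)) = Ico (-Δ) (-(t - t₀)) := by
    ext s
    simp only [mem_inter_iff, mem_Icc, mem_Iio, mem_Ico]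
    constructor
    · exact fun hs => ⟨hs.1.1, hs.2⟩
    · exact fun hs => ⟨⟨hs.1, by linarith [hs.2, ht.1]⟩, hs.2⟩
  rw [integral_congr_ae hae, ← integral_inter_add_sdiff measurableSet_Iio hint, hinter,
    ← setIntegral_Ico_dotProduct_comp_add (sub_nonneg.2 ht.1)]
  congr 1
  · refine setIntegral_congr_fun measurableSet_Ico fun s hs => ?_
    simp only [concat_of_lt (show t + s < t₀ by linarith [hs.2])]
    congr 2
    ring
  · refine setIntegral_congr_fun (measurableSet_Icc.diff measurableSet_Iio) fun s hs => ?_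
    simp only [concat_of_le (show t₀ ≤ t + s by linarith [notMem_Iio.1 hs.2])]

theorem weakStarTendsto_history {φ : ℕ → LInf n Δ} {φ₀ : LInf n Δ} (hlim : WeakStarTendsto φ φ₀)
    {x : ℝ → Fin n → ℝ} (hx : ContinuousOn x (Icc t₀ T)) {t : ℝ} (ht : t ∈ Icc t₀ T) :
    WeakStarTendsto (fun k => history Δ (concat t₀ (φ k) x) t)
      (history Δ (concat t₀ φ₀ x) t) := fun g hg => by
  simp only [integral_dotProduct_history _ hx ht hg]
  exact (hlim _ (integrable_indicator_Ico_comp_sub hg (sub_nonneg.2 ht.1))).add_const _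

theorem WeakStarRegular.ae_tendsto_sub (hf : WeakStarRegular τ f) (R T : ℝ) :
    ∀ᵐ t ∂volume.restrict (Icc 0 T), ∀ (φ : ℕ → LInf n Δ) (φ₀ : LInf n Δ)
      (η : ℕ → Fin (ℓ + 1) → Fin n → ℝ), (∀ k, ‖φ k‖ ≤ R) → WeakStarTendsto φ φ₀ →
      (∀ k, ‖η k‖ ≤ R) → Tendsto (fun k => f t (η k) (φ k) - f t (η k) φ₀) atTop (𝓝 0) := by
  obtain ⟨Z, hZ, h⟩ :=
    hf.weakStar_continuous (max T 1) (by positivity) (max R 1) (by positivity)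
  filter_upwards [ae_restrict_of_ae (measure_eq_zero_iff_ae_notMem.1 hZ),
    ae_restrict_mem measurableSet_Icc] with t htZ ht φ φ₀ η hφ hlim hη
  refine Metric.tendsto_atTop.2 fun ε hε => ?_
  obtain ⟨j, hj⟩ := h ε hε φ φ₀ (fun k => le_max_of_le_left (hφ k)) hlim
  refine ⟨j, fun k hk => ?_⟩
  rw [dist_zero_right]
  exact hj k hk t ⟨⟨ht.1, le_max_of_le_left ht.2⟩, htZ⟩ (η k) (le_max_of_le_left (hη k))

variable {φ : ℕ → LInf n Δ} {φ₀ : LInf n Δ} {x : ℝ → Fin n → ℝ}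

theorem WeakStarRegular.ae_tendsto_pathRHS_sub_mixedRHS (hf : WeakStarRegular τ f)
    (hτ : ∀ i, τ i ∈ Icc 0 Δ) (ht₀ : 0 ≤ t₀) (hφ : ∀ k, ‖φ k‖ ≤ R)
    (hlim : WeakStarTendsto φ φ₀) (hx : ContinuousOn x (Icc t₀ T))
    (hxR : ∀ t ∈ Icc t₀ T, ‖x t‖ ≤ R) :
    ∀ᵐ s ∂volume.restrict (Icc t₀ T), Tendsto (fun k => pathRHS τ f (concat t₀ (φ k) x) s -
      mixedRHS τ f (concat t₀ (φ k) x) (concat t₀ φ₀ x) s) atTop (𝓝 0) := by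
  filter_upwards [ae_restrict_of_ae_restrict_of_subset (Icc_subset_Icc_left ht₀)
      (hf.ae_tendsto_sub R T), ae_all_iff.2 fun k => ae_norm_delayed_le hτ (hφ k) hxR,
    ae_restrict_mem measurableSet_Icc] with s hs hdelayed hmem
  exact hs _ _ _ (fun k => norm_history_le (hφ k) hx hxR hmem)
    (weakStarTendsto_history hlim hx hmem) hdelayed

theorem LipschitzCaratheodory.exists_ae_norm_pathRHS_sub_mixedRHS_le
    (hf : LipschitzCaratheodory τ f) (hτ : ∀ i, τ i ∈ Icc 0 Δ) (ht₀ : 0 ≤ t₀)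
    (hx : ContinuousOn x (Icc t₀ T)) (hxR : ∀ t ∈ Icc t₀ T, ‖x t‖ ≤ R) :
    ∃ B, ∀ φ ψ : LInf n Δ, ‖φ‖ ≤ R → ‖ψ‖ ≤ R → ∀ᵐ s ∂volume.restrict (Icc t₀ T),
      ‖pathRHS τ f (concat t₀ φ x) s - mixedRHS τ f (concat t₀ φ x) (concat t₀ ψ x) s‖ ≤ B := by
  obtain ⟨L, hL⟩ := hf.exists_ae_lipschitz R T
  refine ⟨L * (R + R), fun φ ψ hφ hψ => ?_⟩
  filter_upwards [ae_restrict_of_ae_restrict_of_subset (Icc_subset_Icc_left ht₀) hL,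
    ae_norm_delayed_le hτ hφ hxR, ae_restrict_mem measurableSet_Icc] with s hs hdelayed hmem
  have hφs := norm_history_le hφ hx hxR hmem
  have hψs := norm_history_le hψ hx hxR hmem
  refine (hs _ _ _ _ hdelayed hdelayed hφs hψs).trans ?_
  rw [sub_self, norm_zero, max_eq_right (norm_nonneg _)]
  gcongr
  exact norm_sub_le_of_le hφs hψs

theorem WeakStarRegular.tendsto_integral_norm_pathRHS_sub_mixedRHS (hf : WeakStarRegular τ f)
    (hτ : ∀ i, τ i ∈ Icc 0 Δ) (ht₀ : 0 ≤ t₀) (hφ : ∀ k, ‖φ k‖ ≤ R) (hφ₀ : ‖φ₀‖ ≤ R)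
    (hlim : WeakStarTendsto φ φ₀) (hx : ContinuousOn x (Icc t₀ T))
    (hxR : ∀ t ∈ Icc t₀ T, ‖x t‖ ≤ R)
    (hint : ∀ᶠ k in atTop,
      IntegrableOn (mixedRHS τ f (concat t₀ (φ k) x) (concat t₀ φ₀ x)) (Icc t₀ T)) :
    Tendsto (fun k => ∫ s in Icc t₀ T, ‖pathRHS τ f (concat t₀ (φ k) x) s -
      mixedRHS τ f (concat t₀ (φ k) x) (concat t₀ φ₀ x) s‖) atTop (𝓝 0) := by
  obtain ⟨B, hB⟩ := hf.exists_ae_norm_pathRHS_sub_mixedRHS_le hτ ht₀ hx hxR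
  rw [← integral_zero ℝ ℝ (μ := volume.restrict (Icc t₀ T))]
  refine tendsto_integral_filter_of_dominated_convergence (fun _ => B) ?_ ?_
    (integrable_const B) ?_
  · exact hint.mono fun k hk =>
      ((hf.integrableOn_pathRHS hτ ht₀ (φ k) hx).sub hk).aestronglyMeasurable.norm
  · exact Eventually.of_forall fun k =>
      (hB (φ k) φ₀ (hφ k) hφ₀).mono fun s hs => (norm_norm _).trans_le hs
  · exact (hf.ae_tendsto_pathRHS_sub_mixedRHS hτ ht₀ hφ hlim hx hxR).mono fun s hs =>
      tendsto_zero_iff_norm_tendsto_zero.1 hs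

theorem tendstoUniformlyOn_integral_of_tendsto_integral_norm_sub {E : Type*}
    [NormedAddCommGroup E] [NormedSpace ℝ E] {F G : ℕ → ℝ → E} {H : ℝ → E} {a b : ℝ}
    (hF : ∀ᶠ k in atTop, IntegrableOn (F k) (Icc a b))
    (hG : ∀ᶠ k in atTop, IntegrableOn (G k) (Icc a b))
    (hFG : Tendsto (fun k => ∫ s in Icc a b, ‖F k s - G k s‖) atTop (𝓝 0))
    (hH : TendstoUniformlyOn (fun k t => ∫ s in a..t, G k s) H atTop (Icc a b)) :
    TendstoUniformlyOn (fun k t => ∫ s in a..t, F k s) H atTop (Icc a b) := by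
  refine Metric.tendstoUniformlyOn_iff.2 fun ε hε => ?_
  filter_upwards [hF, hG, hFG.eventually_lt_const (half_pos hε),
    Metric.tendstoUniformlyOn_iff.1 hH (ε / 2) (half_pos hε)] with k hFk hGk hk hHk t ht
  have hsub : Icc a t ⊆ Icc a b := Icc_subset_Icc_right ht.2
  have hii : ∀ {u : ℝ → E}, IntegrableOn u (Icc a b) → IntervalIntegrable u volume a t :=
    fun hu => (intervalIntegrable_iff_integrableOn_Icc_of_le ht.1).2 (hu.mono_set hsub)
  calc dist (H t) (∫ s in a..t, F k s)
      ≤ dist (H t) (∫ s in a..t, G k s) + dist (∫ s in a..t, G k s) (∫ s in a..t, F k s) :=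
        dist_triangle _ _ _
    _ = dist (H t) (∫ s in a..t, G k s) + ‖∫ s in a..t, (F k s - G k s)‖ := by
        rw [intervalIntegral.integral_sub (hii hFk) (hii hGk), dist_comm (∫ s in a..t, G k s),
          dist_eq_norm (∫ s in a..t, F k s)]
    _ ≤ dist (H t) (∫ s in a..t, G k s) + ∫ s in Icc a b, ‖F k s - G k s‖ := by
        gcongr
        refine (intervalIntegral.norm_integral_le_integral_norm ht.1).trans ?_
        rw [intervalIntegral.integral_of_le ht.1]
        exact setIntegral_mono_set (hFk.sub hGk).norm (Eventually.of_forall fun s => norm_nonneg _)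
          (Ioc_subset_Icc_self.trans hsub).eventuallyLE
    _ < ε / 2 + ε / 2 := add_lt_add (hHk t ht) hk
    _ = ε := add_halves ε

theorem WeakStarRegular.eventually_integrableOn_mixedRHS (hf : WeakStarRegular τ f)
    (hτ : ∀ i, τ i ∈ Icc 0 Δ) (ht₀ : 0 ≤ t₀) (hφ : ∀ k, ‖φ k‖ ≤ R)
    (hlim : WeakStarTendsto φ φ₀) (hx : ContinuousOn x (Icc t₀ (t₀ + Δ)))
    (hxR : ∀ t ∈ Icc t₀ (t₀ + Δ), ‖x t‖ ≤ R) :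
    ∀ᶠ k in atTop,
      IntegrableOn (mixedRHS τ f (concat t₀ (φ k) x) (concat t₀ φ₀ x)) (Icc t₀ (t₀ + Δ)) := by
  have hle : t₀ ≤ t₀ + Δ := le_add_of_nonneg_right ((hτ 0).1.trans (hτ 0).2)
  obtain ⟨j, hj⟩ := hf.discrete_integral t₀ ht₀ R ((norm_nonneg _).trans (hφ 0)) x hx hxR φ φ₀ hφ
    hlim 1 one_pos
  filter_upwards [eventually_ge_atTop j] with k hk
  have hsub := (intervalIntegrable_iff_integrableOn_Icc_of_le hle).1
    (hj _ (right_mem_Icc.2 hle) k hk).1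
  exact (hsub.add (hf.integrableOn_pathRHS hτ ht₀ φ₀ hx)).congr_fun
    (fun s _ => sub_add_cancel _ _) measurableSet_Icc

theorem WeakStarRegular.tendstoUniformlyOn_integral_mixedRHS (hf : WeakStarRegular τ f)
    (hτ : ∀ i, τ i ∈ Icc 0 Δ) (ht₀ : 0 ≤ t₀) (hφ : ∀ k, ‖φ k‖ ≤ R)
    (hlim : WeakStarTendsto φ φ₀) (hx : ContinuousOn x (Icc t₀ (t₀ + Δ)))
    (hxR : ∀ t ∈ Icc t₀ (t₀ + Δ), ‖x t‖ ≤ R) :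
    TendstoUniformlyOn
      (fun k t => ∫ s in t₀..t, mixedRHS τ f (concat t₀ (φ k) x) (concat t₀ φ₀ x) s)
      (fun t => ∫ s in t₀..t, pathRHS τ f (concat t₀ φ₀ x) s) atTop (Icc t₀ (t₀ + Δ)) := by
  refine Metric.tendstoUniformlyOn_iff.2 fun ε hε => ?_
  obtain ⟨j, hj⟩ := hf.discrete_integral t₀ ht₀ R ((norm_nonneg _).trans (hφ 0)) x hx hxR φ φ₀ hφ
    hlim ε hε
  filter_upwards [hf.eventually_integrableOn_mixedRHS hτ ht₀ hφ hlim hx hxR,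
    eventually_ge_atTop j] with k hint hk t ht
  have hii : ∀ {u : ℝ → Fin n → ℝ}, IntegrableOn u (Icc t₀ (t₀ + Δ)) →
      IntervalIntegrable u volume t₀ t := fun hu =>
    (intervalIntegrable_iff_integrableOn_Icc_of_le ht.1).2
      (hu.mono_set (Icc_subset_Icc_right ht.2))
  rw [dist_comm, dist_eq_norm,
    ← intervalIntegral.integral_sub (hii hint) (hii (hf.integrableOn_pathRHS hτ ht₀ φ₀ hx))]
  exact (hj t ht k hk).2

theorem LipschitzCaratheodory.integral_pathRHS_sub_eq (hf : LipschitzCaratheodory τ f)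
    (hτ : ∀ i, τ i ∈ Icc 0 Δ) (ht₀ : 0 ≤ t₀) (φ ψ : LInf n Δ) (hx : ContinuousOn x (Icc t₀ T)) :
    (∫ s in t₀..T, pathRHS τ f (concat t₀ φ x) s) - ∫ s in t₀..T, pathRHS τ f (concat t₀ ψ x) s =
      (∫ s in t₀..min T (t₀ + Δ), pathRHS τ f (concat t₀ φ x) s) -
        ∫ s in t₀..min T (t₀ + Δ), pathRHS τ f (concat t₀ ψ x) s := by
  rcases le_or_gt T (t₀ + Δ) with hT | hT
  · rw [min_eq_left hT]
  rw [min_eq_right hT.le]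
  have hle : t₀ ≤ t₀ + Δ := le_add_of_nonneg_right ((hτ 0).1.trans (hτ 0).2)
  have htail : ∫ s in (t₀ + Δ)..T, pathRHS τ f (concat t₀ φ x) s =
      ∫ s in (t₀ + Δ)..T, pathRHS τ f (concat t₀ ψ x) s := by
    refine intervalIntegral.integral_congr fun s hs => ?_
    rw [uIcc_of_le hT.le] at hs
    exact pathRHS_congr hτ ((eqOn_concat_Ici φ ψ x).mono fun u hu =>
      mem_Ici.2 (by linarith [hs.1, hu.1]))
  have hsplit : ∀ χ : LInf n Δ, ∫ s in t₀..T, pathRHS τ f (concat t₀ χ x) s =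
      (∫ s in t₀..(t₀ + Δ), pathRHS τ f (concat t₀ χ x) s) +
        ∫ s in (t₀ + Δ)..T, pathRHS τ f (concat t₀ χ x) s := fun χ => by
    have hint := hf.integrableOn_pathRHS hτ ht₀ χ hx
    refine (intervalIntegral.integral_add_adjacent_intervals ?_ ?_).symm
    · exact (intervalIntegrable_iff_integrableOn_Icc_of_le hle).2
        (hint.mono_set (Icc_subset_Icc_right hT.le))
    · exact (intervalIntegrable_iff_integrableOn_Icc_of_le hT.le).2
        (hint.mono_set (Icc_subset_Icc_left hle))
  rw [hsplit φ, hsplit ψ, htail, add_sub_add_right_eq_sub]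

theorem WeakStarRegular.tendstoUniformlyOn_integral_pathRHS (hf : WeakStarRegular τ f)
    (hτ : ∀ i, τ i ∈ Icc 0 Δ) (ht₀ : 0 ≤ t₀) (hT : t₀ ≤ T) (hφ : ∀ k, ‖φ k‖ ≤ R)
    (hφ₀ : ‖φ₀‖ ≤ R) (hlim : WeakStarTendsto φ φ₀) (hx : ContinuousOn x (Icc t₀ T))
    (hxR : ∀ t ∈ Icc t₀ T, ‖x t‖ ≤ R) :
    TendstoUniformlyOn (fun k t => ∫ s in t₀..t, pathRHS τ f (concat t₀ (φ k) x) s)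
      (fun t => ∫ s in t₀..t, pathRHS τ f (concat t₀ φ₀ x) s) atTop (Icc t₀ T) := by
  have hmaps : MapsTo (min · T) (Icc t₀ (t₀ + Δ)) (Icc t₀ T) := fun u hu =>
    ⟨le_min hu.1 hT, min_le_right u T⟩
  set z : ℝ → Fin n → ℝ := fun u => x (min u T)
  have hz : ContinuousOn z (Icc t₀ (t₀ + Δ)) := hx.comp (by fun_prop) hmaps
  have hzR : ∀ t ∈ Icc t₀ (t₀ + Δ), ‖z t‖ ≤ R := fun t ht => hxR _ (hmaps ht)
  have hint := hf.eventually_integrableOn_mixedRHS hτ ht₀ hφ hlim hz hzR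
  have hshort := tendstoUniformlyOn_integral_of_tendsto_integral_norm_sub
    (Eventually.of_forall fun k => hf.integrableOn_pathRHS hτ ht₀ (φ k) hz) hint
    (hf.tendsto_integral_norm_pathRHS_sub_mixedRHS hτ ht₀ hφ hφ₀ hlim hz hzR hint)
    (hf.tendstoUniformlyOn_integral_mixedRHS hτ ht₀ hφ hlim hz hzR)
  refine Metric.tendstoUniformlyOn_iff.2 fun ε hε => ?_
  filter_upwards [Metric.tendstoUniformlyOn_iff.1 hshort ε hε] with k hk t ht
  have hle : t₀ ≤ t₀ + Δ := le_add_of_nonneg_right ((hτ 0).1.trans (hτ 0).2)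
  have hmin : t₀ ≤ min t (t₀ + Δ) := le_min ht.1 hle
  have hxz : EqOn x z (Icc t₀ (min t (t₀ + Δ))) := fun u hu => by
    simp only [z, min_eq_left ((hu.2.trans (min_le_left _ _)).trans ht.2)]
  rw [dist_eq_norm, hf.integral_pathRHS_sub_eq hτ ht₀ _ _ (hx.mono (Icc_subset_Icc_right ht.2)),
    integral_pathRHS_congr hτ hmin hxz, integral_pathRHS_congr hτ hmin hxz, ← dist_eq_norm]
  exact hk _ ⟨hmin, min_le_right _ _⟩

end WeakStarContinuity

section ContinuousDependence

variable {n ℓ : ℕ} {Δ : ℝ} {τ : Fin (ℓ + 1) → ℝ} {f : RHS n ℓ Δ} {t₀ T R : ℝ}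

theorem WeakStarRegular.eventually_exists_isSolOn_norm_sub_le (hf : WeakStarRegular τ f)
    (hτ : ∀ i, τ i ∈ Icc 0 Δ) (ht₀ : 0 ≤ t₀) (hT : t₀ ≤ T) {ξ : ℕ → Fin n → ℝ}
    {ξ₀ : Fin n → ℝ} {φ : ℕ → LInf n Δ} {φ₀ : LInf n Δ} {x₀ : ℝ → Fin n → ℝ}
    (hφ : ∀ k, ‖φ k‖ ≤ R) (hφ₀ : ‖φ₀‖ ≤ R) (hξlim : Tendsto ξ atTop (𝓝 ξ₀))
    (hφlim : WeakStarTendsto φ φ₀) (hx₀ : IsSolOn τ f t₀ T ξ₀ φ₀ x₀) {ε : ℝ} (hε : 0 < ε) :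
    ∀ᶠ k in atTop, ∃ x, IsSolOn τ f t₀ T (ξ k) (φ k) x ∧ ∀ t ∈ Icc t₀ T, ‖x t - x₀ t‖ ≤ ε := by
  obtain ⟨M, -, hx₀M⟩ := exists_common_bound φ₀ hx₀.continuousOn
  set N := max M R + ε
  have hMN : M + ε ≤ N := add_le_add (le_max_left M R) le_rfl
  have hRN : R ≤ N := (le_max_right M R).trans (le_add_of_nonneg_right hε.le)
  have hx₀N : ∀ t ∈ Icc t₀ T, ‖x₀ t‖ ≤ N := fun t ht => by linarith [hx₀M t ht]
  obtain ⟨L, hL⟩ := hf.exists_retardedLipschitz_clampedRHS hτ N T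
  set δ := ε / (2 * Real.exp (2 * L * (T - t₀)))
  have hδ : 0 < δ := by positivity
  have hlim : TendstoUniformlyOn
      (fun k t => ξ k + ∫ s in t₀..t, pathRHS τ f (concat t₀ (φ k) x₀) s) x₀ atTop (Icc t₀ T) :=
    ((hξlim.tendstoUniformlyOn_const _).add (hf.tendstoUniformlyOn_integral_pathRHS hτ ht₀ hT
      (fun k => (hφ k).trans hRN) (hφ₀.trans hRN) hφlim hx₀.continuousOn hx₀N)).congr_right
      fun t ht => (hx₀.equation t ht).symm
  filter_upwards [Metric.tendstoUniformlyOn_iff.1 hlim δ hδ] with k hk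
  have hLk := hL t₀ ht₀ (φ k) ((hφ k).trans hRN)
  obtain ⟨z, hz⟩ := hLk.exists_isIntegralSolution hT (ξ k)
  have hclose : ∀ t ∈ Icc t₀ T, ‖z t - x₀ t‖ ≤ ε := fun t ht =>
    calc ‖z t - x₀ t‖ ≤ Real.exp (2 * L * (t - t₀)) * (2 * δ) :=
          hLk.norm_sub_le_of_norm_add_integral_sub_le hz hx₀.continuousOn (fun s hs => by
            rw [integral_clampedRHS hτ hx₀N hs, ← dist_eq_norm, dist_comm]
            exact (hk s hs).le) ht
      _ ≤ Real.exp (2 * L * (T - t₀)) * (2 * δ) := by gcongr; exact ht.2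
      _ = ε := by simp only [δ]; field_simp
  refine ⟨z, (isIntegralSolution_clampedRHS_iff hτ fun t ht => ?_).1 hz, hclose⟩
  linarith [norm_le_norm_sub_add (z t) (x₀ t), hclose t ht, hx₀M t ht]

theorem WeakStarRegular.exists_uniform_bound (hf : WeakStarRegular τ f)
    (hτ : ∀ i, τ i ∈ Icc 0 Δ) (ht₀ : 0 ≤ t₀) (hT : t₀ ≤ T)
    (hex : ∀ (ξ : Fin n → ℝ) (φ : LInf n Δ), ‖ξ‖ ≤ R → ‖φ‖ ≤ R → ∃ x, IsSolOn τ f t₀ T ξ φ x) :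
    ∃ B, ∀ (ξ : Fin n → ℝ) (φ : LInf n Δ) (x : ℝ → Fin n → ℝ), ‖ξ‖ ≤ R → ‖φ‖ ≤ R →
      IsSolOn τ f t₀ T ξ φ x → ∀ t ∈ Icc t₀ T, ‖x t‖ ≤ B := by
  by_contra! hunbounded
  choose ξ φ x hξ hφ hx t ht hgt using fun k : ℕ => hunbounded k
  obtain ⟨σ, φ₀, hσ, hφ₀, hφlim⟩ := exists_subseq_weakStarTendsto hφ
  obtain ⟨ξ₀, hξ₀, ρ, hρ, hξlim⟩ := (isCompact_closedBall (0 : Fin n → ℝ) R).tendsto_subseq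
    fun k => mem_closedBall_zero_iff.2 (hξ (σ k))
  obtain ⟨x₀, hx₀⟩ := hex ξ₀ φ₀ (mem_closedBall_zero_iff.1 hξ₀) hφ₀
  obtain ⟨N, -, hx₀N⟩ := exists_common_bound φ₀ hx₀.continuousOn
  obtain ⟨K, hK⟩ := exists_nat_gt (N + 1)
  obtain ⟨k, ⟨z, hz, hzx₀⟩, hkK⟩ := ((hf.eventually_exists_isSolOn_norm_sub_le hτ ht₀ hT
    (fun k => hφ (σ (ρ k))) hφ₀ hξlim (fun g hg => (hφlim g hg).comp hρ.tendsto_atTop) hx₀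
    one_pos).and (eventually_ge_atTop K)).exists
  have hlt : (K : ℝ) ≤ (σ (ρ k) : ℕ) :=
    Nat.cast_le.2 (hkK.trans (hρ.le_apply.trans hσ.le_apply))
  have htk := ht (σ (ρ k))
  have hle := hzx₀ _ htk
  rw [hz.eqOn hf.toLipschitzCaratheodory hτ ht₀ (hx (σ (ρ k))) htk] at hle
  linarith [hgt (σ (ρ k)), norm_le_norm_sub_add (x (σ (ρ k)) (t (σ (ρ k)))) (x₀ (t (σ (ρ k)))),
    hx₀N _ htk]

end ContinuousDependence

end DelaySystem

end

open DelaySystem in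
theorem theorem1_general {n ℓ : ℕ} (τ : Fin (ℓ + 1) → ℝ) (Δ : ℝ) (hτ : ∀ i, τ i ∈ Set.Icc 0 Δ)
    (f : RHS n ℓ Δ) (hf : WeakStarRegular τ f) :
    (∀ t₀ ≥ 0, ∀ (ξ : Fin n → ℝ) (φ : LInf n Δ), ∃ (Tx : EReal) (x : ℝ → Fin n → ℝ),
      IsMaximalSolution τ f t₀ ξ φ (halfOpen t₀ Tx) x ∧
      ∀ (J : Set ℝ) (y : ℝ → Fin n → ℝ), IsMaximalSolution τ f t₀ ξ φ J y →
        J = halfOpen t₀ Tx ∧ Set.EqOn y x J) ∧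
    (∀ t₀ T R : ℝ, 0 ≤ t₀ → t₀ ≤ T →
      (T : EReal) < sInf {Tx : EReal | ∃ (ξ : Fin n → ℝ) (φ : LInf n Δ) (x : ℝ → Fin n → ℝ),
        ‖ξ‖ ≤ R ∧ ‖φ‖ ≤ R ∧ IsMaximalSolution τ f t₀ ξ φ (halfOpen t₀ Tx) x} →
      BddAbove {r : ℝ | ∃ (ξ : Fin n → ℝ) (φ : LInf n Δ) (Tx : EReal) (x : ℝ → Fin n → ℝ),
        ‖ξ‖ ≤ R ∧ ‖φ‖ ≤ R ∧ IsMaximalSolution τ f t₀ ξ φ (halfOpen t₀ Tx) x ∧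
        ∃ t ∈ Set.Icc t₀ T, r = ‖x t‖}) := by
  have hf' := hf.toLipschitzCaratheodory
  refine ⟨fun t₀ ht₀ ξ φ => exists_isMaximalSolution_unique hf' hτ ht₀ ξ φ,
    fun t₀ T R ht₀ hT hinf => ?_⟩
  have hsol : ∀ {ξ : Fin n → ℝ} {φ : LInf n Δ} {Tx : EReal} {x : ℝ → Fin n → ℝ}, ‖ξ‖ ≤ R →
      ‖φ‖ ≤ R → IsMaximalSolution τ f t₀ ξ φ (halfOpen t₀ Tx) x → IsSolOn τ f t₀ T ξ φ x :=
    fun {ξ φ Tx x} hξ hφ hx => ((isMaximalSolution_iff hf' hτ ht₀).1 hx).2 T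
      ⟨hT, hinf.trans_le (sInf_le ⟨ξ, φ, x, hξ, hφ, hx⟩)⟩
  obtain ⟨B, hB⟩ := hf.exists_uniform_bound hτ ht₀ hT fun ξ φ hξ hφ =>
    let ⟨_, x, hx, _⟩ := exists_isMaximalSolution_unique hf' hτ ht₀ ξ φ
    ⟨x, hsol hξ hφ hx⟩
  refine ⟨B, ?_⟩
  rintro r ⟨ξ, φ, Tx, x, hξ, hφ, hx, t, ht, rfl⟩
  exact hB ξ φ x hξ hφ (hsol hξ hφ hx) t ht

open DelaySystem in
theorem theorem1 {n ℓ : ℕ} (hℓ : 1 ≤ ℓ) (τ : Fin (ℓ + 1) → ℝ) (hτ₀ : τ 0 = 0)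
    (hτ : StrictMono τ) (Δ : ℝ) (hΔ : τ (Fin.last ℓ) = Δ) (f : RHS n ℓ Δ)
    (hf : WeakStarRegular τ f) :
    -- well-posedness: there is a unique maximal solution, and its domain is `[t₀, Tx)`
    (∀ t₀ ≥ 0, ∀ (ξ : Fin n → ℝ) (φ : LInf n Δ), ∃ (Tx : EReal) (x : ℝ → Fin n → ℝ),
      IsMaximalSolution τ f t₀ ξ φ (halfOpen t₀ Tx) x ∧
      ∀ (J : Set ℝ) (y : ℝ → Fin n → ℝ), IsMaximalSolution τ f t₀ ξ φ J y →
        J = halfOpen t₀ Tx ∧ Set.EqOn y x J) ∧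
    -- uniform boundedness if the existence times are uniformly greater than `T`
    (∀ t₀ T R : ℝ, 0 ≤ t₀ → t₀ < T → 0 < R →
      (T : EReal) < sInf {Tx : EReal | ∃ (ξ : Fin n → ℝ) (φ : LInf n Δ) (x : ℝ → Fin n → ℝ),
        ‖ξ‖ ≤ R ∧ ‖φ‖ ≤ R ∧ IsMaximalSolution τ f t₀ ξ φ (halfOpen t₀ Tx) x} →
      BddAbove {r : ℝ | ∃ (ξ : Fin n → ℝ) (φ : LInf n Δ) (Tx : EReal) (x : ℝ → Fin n → ℝ),
        ‖ξ‖ ≤ R ∧ ‖φ‖ ≤ R ∧ IsMaximalSolution τ f t₀ ξ φ (halfOpen t₀ Tx) x ∧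
        ∃ t ∈ Set.Icc t₀ T, r = ‖x t‖}) := by
  have h := theorem1_general τ Δ
    (fun i => ⟨hτ₀ ▸ hτ.monotone (Fin.zero_le i), hΔ ▸ hτ.monotone (Fin.le_last i)⟩) f hf
  exact ⟨h.1, fun t₀ T R ht₀ hT _ => h.2 t₀ T R ht₀ hT.le⟩
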